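/- Let $G$ be a matrix Lie group of dimension $n$, i.e. a closed subgroup of $GL_N(\mathbb R)$ or $GL_N(\mathbb C)$, with Lie algebra $\mathfrak g=\{X : e^{tX}\in G \text{ for all } t\in\mathbb R\}$, and suppose that $\exp:\mathfrak g\to G$ is surjective. Fix a basis of the real vector space $\mathfrak g$ and let $\mathcal M:\mathbb R^n\to\mathfrak g$ be the corresponding linear isomorphism. For $\mu\in G$ and a symmetric positive-definite $\Sigma\in\mathbb R^{n\times n}$, let $\mathcal T_G(\mu,\Sigma)$ denote the law on $G$ of $e^{\mathcal M(\xi)}\mu$ with $\xi\sim\mathcal N(0,\Sigma)$ (a concentrated Gaussian). Let $f$ be a smooth vector field on $G$ (a smooth matrix-valued map with $f(g)\in T_gG=\mathfrak g\,g$ for all $g \in G$) that is group-affine: $$f(g_1g_2)=f(g_1)g_2+g_1f(g_2)-g_1f(I)g_2\qquad\text{for all } g_1,g_2\in G.$$ Then there are a derivation $D$ of $\mathfrak g$ and $Y_1,Y_2\in\mathfrak g$ such that, for all $X\in\mathfrak g$, $$f(e^X)=e^XJ(X)DX+e^XY_1+Y_2e^X,\qquad J(X)=\int_0^1e^{-s\,\mathrm{ad}_X}\,ds,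 \tag{1}$$ and for every $g_0\in G$ the initial value problem $\dot g=f(g)$, $g(0)=g_0$ has a unique solution $g:[0,\infty)\to G$. Moreover, let $\mu_0\in G$, let $\Sigma_0\in\mathbb R^{n\times n}$ be symmetric positive-definite, let $D,Y_1,Y_2$ be any triple as in (1), and let $A\in\mathbb R^{n\times n}$ be the matrix of $D+\mathrm{ad}_{Y_2}$ in the chosen basis. Let $\mu:[0,\infty)\to G$ be the solution of $\dot\mu=f(\mu)$, $\mu(0)=\mu_0$. Then the Lyapunov equation $$\dot\Sigma=A\Sigma+\Sigma A^{T},\qquad \Sigma(0)=\Sigma_0,$$ has a unique solution $\Sigma:[0,\infty)\to\mathbb R^{n\times n}$, $\Sigma(t)$ is symmetric positive-definite for all $t\ge0$, and, whenever $g_0$ is a random element of $G$ with $g_0\sim\mathcal T_G(\mu_0,\Sigma_0)$ and $g$ is a random process whose paths almost surely solve $\dot g=f(g)$, $g(0)=g_0$ on $[0,\infty)$, $$g(t)\sim\mathcal T_G(\mu(t),\Sigma(t))\qquad\text{for all } t\ge0.$$ -/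

import Mathlib

open scoped Matrix Matrix.Norms.Operator Topology
open MeasureTheory ProbabilityTheory

attribute [local instance] LieRing.ofAssociativeRing

noncomputable section

namespace MatrixLieGroup

variable {𝕜 : Type*} [RCLike 𝕜] {N : ℕ}

/-- The exponential of a square matrix, as an element of the general linear group. -/
def expGL (X : Matrix (Fin N) (Fin N) 𝕜) : GL (Fin N) 𝕜 where
  val := NormedSpace.exp X
  inv := NormedSpace.exp (-X)
  val_inv := by
    rw [← Matrix.exp_add_of_commute _ _ (Commute.refl X).neg_right, add_neg_cancel,
      NormedSpace.exp_zero]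
  inv_val := by
    rw [← Matrix.exp_add_of_commute _ _ (Commute.refl X).neg_left, neg_add_cancel,
      NormedSpace.exp_zero]

theorem coe_expGL (X : Matrix (Fin N) (Fin N) 𝕜) :
    (expGL X : Matrix (Fin N) (Fin N) 𝕜) = NormedSpace.exp X := rfl

theorem norm_pow_sub_pow_le (A B : Matrix (Fin N) (Fin N) 𝕜) (r : ℝ) (hr : 1 ≤ r)
    (hA : ‖A‖ ≤ r) (hB : ‖B‖ ≤ r) (k : ℕ) :
    ‖A ^ k - B ^ k‖ ≤ k * r ^ k * ‖A - B‖ := by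
  have h1 : ‖(1 : Matrix (Fin N) (Fin N) 𝕜)‖ ≤ 1 := by
    rcases isEmpty_or_nonempty (Fin N) with h | h
    · have : (1 : Matrix (Fin N) (Fin N) 𝕜) = 0 := Subsingleton.elim _ _
      rw [this, norm_zero]; exact zero_le_one
    · exact norm_one.le
  have hBp : ∀ j : ℕ, ‖B ^ j‖ ≤ r ^ j := by
    intro j
    induction j with
    | zero => simpa using h1
    | succ j ih =>
      rw [pow_succ, pow_succ]
      exact (norm_mul_le _ _).trans (mul_le_mul ih hB (norm_nonneg _) (by positivity))
  induction k with
  | zero => simp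
  | succ k ih =>
    have e : A ^ (k + 1) - B ^ (k + 1) = A * (A ^ k - B ^ k) + (A - B) * B ^ k := by
      rw [pow_succ', pow_succ']; noncomm_ring
    rw [e]
    have i1 : ‖A * (A ^ k - B ^ k)‖ ≤ r * (k * r ^ k * ‖A - B‖) :=
      (norm_mul_le _ _).trans (mul_le_mul hA ih (norm_nonneg _) (by positivity))
    have i2 : ‖(A - B) * B ^ k‖ ≤ ‖A - B‖ * r ^ k :=
      (norm_mul_le _ _).trans (mul_le_mul_of_nonneg_left (hBp k) (norm_nonneg _))
    have i3 : r ^ k ≤ r ^ (k + 1) := pow_le_pow_right₀ hr (Nat.le_succ k)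
    have i4 := mul_le_mul_of_nonneg_left i3 (norm_nonneg (A - B))
    refine (norm_add_le _ _).trans ?_
    push_cast
    have : r * (k * r ^ k * ‖A - B‖) = k * r ^ (k + 1) * ‖A - B‖ := by ring
    linarith

theorem hasDerivAt_coe_expGL (X : Matrix (Fin N) (Fin N) 𝕜) :
    HasDerivAt (fun s : ℝ => (expGL (s • X) : Matrix (Fin N) (Fin N) 𝕜)) X 0 := by
  have h := hasDerivAt_exp_smul_const (𝕂 := ℝ) X (0 : ℝ)
  rw [zero_smul, NormedSpace.exp_zero, one_mul] at h
  exact h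

open Filter Asymptotics in
/-- A curve through the identity with velocity `X` has `γ (t / k) ^ k → exp (t X)`. -/
theorem tendsto_pow_exp {γ : ℝ → Matrix (Fin N) (Fin N) 𝕜} {X : Matrix (Fin N) (Fin N) 𝕜}
    (h0 : γ 0 = 1) (hγ : HasDerivAt γ X 0) (t : ℝ) :
    Tendsto (fun k : ℕ => γ (t / k) ^ k) atTop (𝓝 (NormedSpace.exp (t • X))) := by
  have h1 : ‖(1 : Matrix (Fin N) (Fin N) 𝕜)‖ ≤ 1 := by
    rcases isEmpty_or_nonempty (Fin N) with h | h
    · have : (1 : Matrix (Fin N) (Fin N) 𝕜) = 0 := Subsingleton.elim _ _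
      rw [this, norm_zero]; exact zero_le_one
    · exact norm_one.le
  have hδ := hasDerivAt_coe_expGL X
  have hδ0 : (expGL ((0 : ℝ) • X) : Matrix (Fin N) (Fin N) 𝕜) = 1 := by
    rw [zero_smul, coe_expGL, NormedSpace.exp_zero]
  set δ : ℝ → Matrix (Fin N) (Fin N) 𝕜 := fun s => expGL (s • X) with hδdef
  have hlim : Tendsto (fun k : ℕ => t / (k : ℝ)) atTop (𝓝 0) :=
    tendsto_const_div_atTop_nhds_zero_nat t
  have bd : ∀ η : ℝ → Matrix (Fin N) (Fin N) 𝕜, η 0 = 1 → HasDerivAt η X 0 →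
      ∃ C : ℝ, 0 ≤ C ∧ ∀ᶠ s in 𝓝 (0 : ℝ), ‖η s‖ ≤ 1 + C * |s| := by
    intro η hη0 hη
    obtain ⟨C, hC, hb⟩ := hη.isBigO_sub.exists_nonneg
    refine ⟨C, hC, ?_⟩
    filter_upwards [hb.bound] with s hs
    rw [hη0, sub_zero, Real.norm_eq_abs] at hs
    have : η s = 1 + (η s - 1) := by abel
    rw [this]
    exact (norm_add_le _ _).trans (add_le_add h1 hs)
  obtain ⟨C₁, hC₁, hb₁⟩ := bd γ h0 hγ
  obtain ⟨C₂, hC₂, hb₂⟩ := bd δ hδ0 hδ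
  have hlo : (fun s => γ s - δ s) =o[𝓝 0] fun s : ℝ => s := by
    have h := (hγ.sub hδ).isLittleO
    have e1 : (fun s => (γ - δ) s - (γ - δ) 0 - (s - 0) • (X - X)) = fun s => γ s - δ s := by
      funext s
      simp only [Pi.sub_apply, h0, sub_self, smul_zero, sub_zero]
      rw [show δ 0 = 1 from hδ0, sub_self, sub_zero]
    have h' : (fun s => (γ - δ) s - (γ - δ) 0 - (s - 0) • (X - X)) =o[𝓝 0]
        fun s : ℝ => s - 0 := h
    rw [e1] at h'
    simpa only [sub_zero] using h'
  have hpow : ∀ k : ℕ, k ≠ 0 → δ (t / k) ^ k = NormedSpace.exp (t • X) := by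
    intro k hk
    simp only [hδdef, coe_expGL]
    rw [← Matrix.exp_nsmul, ← Nat.cast_smul_eq_nsmul ℝ, smul_smul, mul_div_cancel₀]
    exact_mod_cast hk
  refine tendsto_iff_norm_sub_tendsto_zero.2 ?_
  set C := C₁ + C₂
  have key : Tendsto (fun k : ℕ => Real.exp (C * |t|) * ((k : ℝ) * ‖γ (t / k) - δ (t / k)‖))
      atTop (𝓝 0) := by
    rw [← mul_zero (Real.exp (C * |t|))]
    refine Tendsto.const_mul _ ?_
    have h2 : (fun k : ℕ => γ (t / k) - δ (t / k)) =o[atTop] fun k : ℕ => t / (k : ℝ) :=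
      hlo.comp_tendsto hlim
    have h3 : (fun k : ℕ => t / (k : ℝ)) =O[atTop] fun k : ℕ => (k : ℝ)⁻¹ := by
      simp only [div_eq_mul_inv]
      exact isBigO_const_mul_self t _ _
    have h4 := (h2.trans_isBigO h3).norm_left.tendsto_div_nhds_zero
    refine h4.congr fun k => ?_
    rw [div_inv_eq_mul, mul_comm]
  refine squeeze_zero' (Eventually.of_forall fun _ => norm_nonneg _) ?_ key
  filter_upwards [hlim.eventually hb₁, hlim.eventually hb₂, eventually_ne_atTop 0]
    with k e₁ e₂ hk
  have hk' : (0 : ℝ) < k := by exact_mod_cast Nat.pos_of_ne_zero hk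
  have hr : ∀ {c : ℝ}, c ≤ C → 1 + c * |t / k| ≤ 1 + C * |t / k| := fun h =>
    add_le_add le_rfl (mul_le_mul_of_nonneg_right h (abs_nonneg _))
  have hle := norm_pow_sub_pow_le (γ (t / k)) (δ (t / k)) (1 + C * |t / k|)
    (le_add_of_nonneg_right (by positivity)) (e₁.trans (hr (by simp [C, hC₂])))
    (e₂.trans (hr (by simp [C, hC₁]))) k
  rw [hpow k hk] at hle
  refine hle.trans ?_
  have hexp : (1 + C * |t / k|) ^ k ≤ Real.exp (C * |t|) := by
    have : Real.exp (C * |t|) = Real.exp (C * |t / k|) ^ k := by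
      rw [← Real.exp_nat_mul, abs_div, abs_of_pos hk']
      congr 1
      field_simp
    rw [this]
    refine pow_le_pow_left₀ (by positivity) ?_ k
    rw [add_comm]
    exact Real.add_one_le_exp _
  calc (k : ℝ) * (1 + C * |t / k|) ^ k * ‖γ (t / k) - δ (t / k)‖
      = (1 + C * |t / k|) ^ k * (k * ‖γ (t / k) - δ (t / k)‖) := by ring
    _ ≤ _ := mul_le_mul_of_nonneg_right hexp (by positivity)

open Filter in
/-- The velocity at the identity of a curve in `G` generates a one-parameter group in `G`. -/
theorem expGL_mem_of_curve (G : ClosedSubgroup (GL (Fin N) 𝕜)) {γ : ℝ → GL (Fin N) 𝕜}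
    {X : Matrix (Fin N) (Fin N) 𝕜} (hG : ∀ s, γ s ∈ G) (h0 : γ 0 = 1)
    (hγ : HasDerivAt (fun s => (γ s : Matrix (Fin N) (Fin N) 𝕜)) X 0) (t : ℝ) :
    expGL (t • X) ∈ G := by
  have h := tendsto_pow_exp (by rw [h0]; rfl) hγ t
  have h' : Tendsto (fun k : ℕ => γ (t / k) ^ k) atTop (𝓝 (expGL (t • X))) := by
    refine (Units.isOpenEmbedding_val.isInducing.tendsto_nhds_iff
      (f := fun k : ℕ => γ (t / k) ^ k)).2 ?_
    refine Tendsto.congr (fun k => ?_) h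
    simp
  exact G.isClosed'.mem_of_tendsto h' (Eventually.of_forall fun k => pow_mem (hG _) k)

/-- The matrices `X` with `exp (t X) ∈ G` for every real `t`, as a real vector space. -/
def lieSubmodule (G : ClosedSubgroup (GL (Fin N) 𝕜)) :
    Submodule ℝ (Matrix (Fin N) (Fin N) 𝕜) where
  carrier := {X | ∀ t : ℝ, expGL (t • X) ∈ G}
  zero_mem' := by
    intro t
    have : expGL (t • (0 : Matrix (Fin N) (Fin N) 𝕜)) = 1 := by
      ext1; simp [coe_expGL]
    rw [this]; exact one_mem G
  add_mem' := by
    intro X Y hX hY t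
    refine expGL_mem_of_curve G (γ := fun s => expGL (s • X) * expGL (s • Y))
      (fun s => mul_mem (hX s) (hY s)) ?_ ?_ t
    · ext1; simp [coe_expGL]
    · have h := (hasDerivAt_coe_expGL X).mul (hasDerivAt_coe_expGL Y)
      simp only [zero_smul, coe_expGL, NormedSpace.exp_zero, one_mul, mul_one] at h
      exact h
  smul_mem' := by
    intro c X hX t
    rw [smul_smul]; exact hX _

theorem conj_mem_lieSubmodule (G : ClosedSubgroup (GL (Fin N) 𝕜)) {g : GL (Fin N) 𝕜} (hg : g ∈ G)
    {Y : Matrix (Fin N) (Fin N) 𝕜} (hY : Y ∈ lieSubmodule G) :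
    (g : Matrix (Fin N) (Fin N) 𝕜) * Y * ((g⁻¹ : GL (Fin N) 𝕜) : Matrix (Fin N) (Fin N) 𝕜) ∈ lieSubmodule G := by
  intro t
  have : expGL (t • ((g : Matrix (Fin N) (Fin N) 𝕜) * Y *
      ((g⁻¹ : GL (Fin N) 𝕜) : Matrix (Fin N) (Fin N) 𝕜))) =
      g * expGL (t • Y) * g⁻¹ := by
    ext1
    rw [← smul_mul_assoc, ← mul_smul_comm]
    exact Matrix.exp_units_conj g (t • Y)
  rw [this]
  exact mul_mem (mul_mem hg (hY t)) (inv_mem hg)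

theorem lie_mem_lieSubmodule (G : ClosedSubgroup (GL (Fin N) 𝕜))
    {X Y : Matrix (Fin N) (Fin N) 𝕜} (hX : X ∈ lieSubmodule G) (hY : Y ∈ lieSubmodule G) :
    ⁅X, Y⁆ ∈ lieSubmodule G := by
  set c : ℝ → Matrix (Fin N) (Fin N) 𝕜 :=
    fun s => expGL (s • X) * Y * (expGL (s • (-X)) : GL (Fin N) 𝕜) with hc
  have hmem : ∀ s, c s ∈ lieSubmodule G := by
    intro s
    have h : ((expGL (s • X))⁻¹ : GL (Fin N) 𝕜) = expGL (s • (-X)) := by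
      ext1
      rw [smul_neg]; rfl
    have := conj_mem_lieSubmodule G (hX s) hY
    rwa [h] at this
  have hd : HasDerivAt c (X * Y - Y * X) 0 := by
    have h := ((hasDerivAt_coe_expGL X).mul_const Y).mul (hasDerivAt_coe_expGL (-X))
    simp only [zero_smul, coe_expGL, NormedSpace.exp_zero, one_mul, mul_one, mul_neg,
      ← sub_eq_add_neg] at h
    exact h
  have hcl : IsClosed (lieSubmodule G : Set (Matrix (Fin N) (Fin N) 𝕜)) :=
    Submodule.closed_of_finiteDimensional _
  rw [Ring.lie_def]
  refine hcl.mem_of_tendsto (hasDerivAt_iff_tendsto_slope.1 hd) (Filter.Eventually.of_forall ?_)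
  intro s
  exact (lieSubmodule G).smul_mem _ ((lieSubmodule G).sub_mem (hmem _) (hmem _))

/-- The Lie algebra of a closed subgroup `G` of the general linear group: all matrices `X` with
`exp (t X) ∈ G` for every real `t`, with the commutator bracket. -/
def lieAlg (G : ClosedSubgroup (GL (Fin N) 𝕜)) :
    LieSubalgebra ℝ (Matrix (Fin N) (Fin N) 𝕜) where
  toSubmodule := lieSubmodule G
  lie_mem' := fun hX hY => lie_mem_lieSubmodule G hX hY

variable (G : ClosedSubgroup (GL (Fin N) 𝕜))

/-- The Borel σ-algebra of `G`. -/
instance instMeasurableSpaceGroup : MeasurableSpace G := borel G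

instance instBorelSpaceGroup : BorelSpace G := ⟨rfl⟩

variable {G}

/-- The matrix underlying a group element. -/
def toMat (g : G) : Matrix (Fin N) (Fin N) 𝕜 := ((g : GL (Fin N) 𝕜) : Matrix (Fin N) (Fin N) 𝕜)

/-- The exponential map from the Lie algebra to the group. -/
def expG (X : lieAlg G) : G :=
  ⟨expGL (X : Matrix (Fin N) (Fin N) 𝕜), by
    have h : ∀ t : ℝ, expGL (t • (X : Matrix (Fin N) (Fin N) 𝕜)) ∈ G := X.2
    simpa using h 1⟩

/-- `f` is a smooth map on `G`: near each point of `G` it extends to a smooth map on an open set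
of matrices. -/
def IsSmooth (f : G → Matrix (Fin N) (Fin N) 𝕜) : Prop :=
  ∀ g : G, ∃ (U : Set (Matrix (Fin N) (Fin N) 𝕜))
    (F : Matrix (Fin N) (Fin N) 𝕜 → Matrix (Fin N) (Fin N) 𝕜),
    IsOpen U ∧ toMat g ∈ U ∧ ContDiffOn ℝ (⊤ : ℕ∞) F U ∧ ∀ h : G, toMat h ∈ U → F (toMat h) = f h

/-- `f` is a vector field on `G`: `f g` lies in the tangent space `𝔤 g` of `G` at `g`. -/
def IsTangent (f : G → Matrix (Fin N) (Fin N) 𝕜) : Prop :=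
  ∀ g : G, ∃ X : lieAlg G, f g = (X : Matrix (Fin N) (Fin N) 𝕜) * toMat g

/-- The group-affine property. -/
def IsGroupAffine (f : G → Matrix (Fin N) (Fin N) 𝕜) : Prop :=
  ∀ g₁ g₂ : G, f (g₁ * g₂) =
    f g₁ * toMat g₂ + toMat g₁ * f g₂ - toMat g₁ * f 1 * toMat g₂

/-- `g : [0, ∞) → G` solves `ġ = f g`, `g 0 = g₀` (values at negative times are irrelevant). -/
def IsSolution (f : G → Matrix (Fin N) (Fin N) 𝕜) (g₀ : G) (g : ℝ → G) : Prop :=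
  g 0 = g₀ ∧ ∀ t : ℝ, 0 ≤ t → HasDerivWithinAt (fun s => toMat (g s)) (f (g t)) (Set.Ici 0) t

variable {n : ℕ} (b : Module.Basis (Fin n) ℝ (lieAlg G))

/-- The Jacobian `J(X) = ∫₀¹ exp (-s ad_X) ds` of the exponential map, a linear map on the Lie
algebra; the integral is computed on matrices with respect to the basis `b`. -/
def jacobian (X : lieAlg G) : lieAlg G →ₗ[ℝ] lieAlg G :=
  Matrix.toLin b b
    (∫ s in (0 : ℝ)..1,
      NormedSpace.exp (-(s • LinearMap.toMatrix b b (LieAlgebra.ad ℝ (lieAlg G) X))))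

/-- `f (e^X) = e^X J(X) (D X) + e^X Y₁ + Y₂ e^X` for all `X` in the Lie algebra. -/
def HasForm (f : G → Matrix (Fin N) (Fin N) 𝕜)
    (D : LieDerivation ℝ (lieAlg G) (lieAlg G)) (Y₁ Y₂ : lieAlg G) : Prop :=
  ∀ X : lieAlg G, f (expG X) =
    toMat (expG X) * (jacobian b X (D X) : Matrix (Fin N) (Fin N) 𝕜)
      + toMat (expG X) * (Y₁ : Matrix (Fin N) (Fin N) 𝕜)
      + (Y₂ : Matrix (Fin N) (Fin N) 𝕜) * toMat (expG X)

/-- The matrix of `D + ad_Y` with respect to the basis `b`. -/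
def driftMatrix (D : LieDerivation ℝ (lieAlg G) (lieAlg G)) (Y : lieAlg G) :
    Matrix (Fin n) (Fin n) ℝ :=
  LinearMap.toMatrix b b ((D : lieAlg G →ₗ[ℝ] lieAlg G) + LieAlgebra.ad ℝ (lieAlg G) Y)

/-- The matrization map `ℝⁿ → 𝔤` given by the basis `b`. -/
def matrize (ξ : EuclideanSpace ℝ (Fin n)) : lieAlg G := ∑ i, ξ i • b i

/-- The (left) concentrated Gaussian distribution on `G`: the law of `exp (M ξ) μ`, where
`ξ ∼ N(0, S)`; the map `ξ ↦ exp (M ξ) μ` is continuous, so the push-forward is not a junk value. -/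
def concentratedGaussian (μ : G) (S : Matrix (Fin n) (Fin n) ℝ) : Measure G :=
  (multivariateGaussian 0 S).map fun ξ => expG (matrize b ξ) * μ

end MatrixLieGroup

/-- `S : [0, ∞) → ℝⁿˣⁿ` solves `Ṡ = A S + S Aᵀ`, `S 0 = S₀`. -/
def IsLyapunovSolution {n : ℕ} (A S₀ : Matrix (Fin n) (Fin n) ℝ)
    (S : ℝ → Matrix (Fin n) (Fin n) ℝ) : Prop :=
  S 0 = S₀ ∧ ∀ t : ℝ, 0 ≤ t → HasDerivWithinAt S (A * S t + S t * Aᵀ) (Set.Ici 0) t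

end

/-! Put δ(g) = f(g) − g f(I) (`multPart`). Group-affinity becomes the Leibniz rule δ(gh) = δ(g)h +
gδ(h), so δ is governed by its differential T at the identity, which restricts to a derivation of 𝔤.
Integrating along s ↦ e^{sX} gives δ(e^X) = e^X ∫₀¹ e^{-sX} (TX) e^{sX} ds
(`IsGroupAffine.multPart_expG`). The integral is J(X)TX, since e^{-s ad_X} is conjugation by
e^{-sX}; this is (1) with D = T, Y₁ = f(I), Y₂ = 0. Conversely, differentiating any representation
(1) at the identity forces T = D + ad_{Y₂} (`HasForm.linearization_eq`), so A is the matrix of T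
whichever triple is used.

Along a solution the velocity Z = f(g)g⁻¹ satisfies Z' = TZ. The initial value problem thus splits
into two successive linear equations, Z' = TZ and g' = Zg, which yields global existence and
uniqueness.

The formula for δ(e^X) is also Duhamel's formula for the derivative of exp at X in the direction TX.
Hence X(t) = e^{tA}X gives (e^{X(t)})' = δ(e^{X(t)}), and the group-affine identity makes
e^{X(t)}μ(t) a solution (`IsGroupAffine.isSolution_expG_linFlow_mul`). In exponential coordinates
centred at μ(t) the flow is the linear map e^{tA}, whether or not exp is injective. It carries N(0,
Σ₀) to N(0, e^{tA}Σ₀e^{tAᵀ}), and this covariance solves the Lyapunov equation. -/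

noncomputable section

/-! ### Linear differential equations: uniqueness and global existence. -/

section LinearODE

variable {E : Type*} [NormedAddCommGroup E] [NormedSpace ℝ E]

theorem HasDerivWithinAt.of_Icc_right {u : ℝ → E} {u' : E} {a c t : ℝ}
    (h : HasDerivWithinAt u u' (Set.Icc a c) t) (ht : t ∈ Set.Ico a c) :
    HasDerivWithinAt u u' (Set.Ici t) t :=
  h.mono_of_mem_nhdsWithin (Filter.mem_of_superset (Icc_mem_nhdsGE ht.2)
    (Set.Icc_subset_Icc_left ht.1))

/-- Uniqueness for linear differential inequalities on a compact interval. -/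
theorem eq_zero_of_norm_deriv_le_Icc {u u' : ℝ → E} {c K : ℝ}
    (hu : ∀ t ∈ Set.Icc 0 c, HasDerivWithinAt u (u' t) (Set.Icc 0 c) t) (h0 : u 0 = 0)
    (hK : ∀ t ∈ Set.Icc 0 c, ‖u' t‖ ≤ K * ‖u t‖) : ∀ t ∈ Set.Icc 0 c, u t = 0 :=
  eq_zero_of_abs_deriv_le_mul_abs_self_of_eq_zero_right
    (fun t ht => (hu t ht).continuousWithinAt)
    (fun t ht => (hu t (Set.Ico_subset_Icc_self ht)).of_Icc_right ht) h0
    (fun t ht => hK t (Set.Ico_subset_Icc_self ht))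

/-- Uniqueness for linear differential inequalities on `[0, ∞)`. -/
theorem eq_zero_of_norm_deriv_le {u u' : ℝ → E}
    (hu : ∀ t, 0 ≤ t → HasDerivWithinAt u (u' t) (Set.Ici 0) t) (h0 : u 0 = 0)
    {K : ℝ → ℝ} (hK : ContinuousOn K (Set.Ici 0)) (hle : ∀ t, 0 ≤ t → ‖u' t‖ ≤ K t * ‖u t‖)
    {t : ℝ} (ht : 0 ≤ t) : u t = 0 := by
  obtain ⟨C, hC⟩ := isCompact_Icc.exists_bound_of_continuousOn
    (hK.mono (Set.Icc_subset_Ici_self : Set.Icc 0 t ⊆ _))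
  refine eq_zero_of_norm_deriv_le_Icc (K := C)
    (fun s hs => (hu s hs.1).mono Set.Icc_subset_Ici_self) h0 (fun s hs => ?_) t ⟨ht, le_rfl⟩
  exact (hle s hs.1).trans
    (mul_le_mul_of_nonneg_right ((le_abs_self _).trans (hC s hs)) (norm_nonneg _))

theorem eq_of_hasDerivWithinAt_clm {T : E →L[ℝ] E} {u v : ℝ → E}
    (hu : ∀ t, 0 ≤ t → HasDerivWithinAt u (T (u t)) (Set.Ici 0) t)
    (hv : ∀ t, 0 ≤ t → HasDerivWithinAt v (T (v t)) (Set.Ici 0) t) (h0 : u 0 = v 0)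
    {t : ℝ} (ht : 0 ≤ t) : u t = v t :=
  sub_eq_zero.1 (eq_zero_of_norm_deriv_le (u := fun s => u s - v s)
    (u' := fun s => T (u s) - T (v s)) (K := fun _ => ‖T‖)
    (fun s hs => (hu s hs).sub (hv s hs)) (sub_eq_zero.2 h0) continuousOn_const
    (fun s _ => by rw [← map_sub]; exact T.le_opNorm _) ht)

/-- A curve on `[0, ∞)` with vanishing derivative is constant. -/
theorem eq_of_hasDerivWithinAt_zero {u : ℝ → E}
    (hu : ∀ t, 0 ≤ t → HasDerivWithinAt u 0 (Set.Ici 0) t) {t : ℝ} (ht : 0 ≤ t) : u t = u 0 := by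
  have := eq_zero_of_norm_deriv_le (u := fun s => u s - u 0) (u' := fun _ => 0) (K := fun _ => 0)
    (fun s hs => (hu s hs).sub_const _) (sub_self _) continuousOn_const (by simp) ht
  exact sub_eq_zero.1 this

/-- Truncation of a vector at norm `R`. -/
def radialTrunc (R : ℝ) (x : E) : E := (R / max R ‖x‖) • x

theorem norm_radialTrunc_le {R : ℝ} (hR : 0 < R) (x : E) : ‖radialTrunc R x‖ ≤ R := by
  have hm : 0 < max R ‖x‖ := lt_max_of_lt_left hR
  rw [radialTrunc, norm_smul, Real.norm_of_nonneg (by positivity), div_mul_eq_mul_div,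
    div_le_iff₀ hm]
  exact mul_le_mul_of_nonneg_left (le_max_right _ _) hR.le

theorem norm_radialTrunc_le_norm {R : ℝ} (hR : 0 < R) (x : E) : ‖radialTrunc R x‖ ≤ ‖x‖ := by
  have hm : 0 < max R ‖x‖ := lt_max_of_lt_left hR
  rw [radialTrunc, norm_smul, Real.norm_of_nonneg (by positivity)]
  exact mul_le_of_le_one_left (norm_nonneg _) ((div_le_one hm).2 (le_max_left _ _))

theorem radialTrunc_of_le {R : ℝ} (hR : 0 < R) {x : E} (hx : ‖x‖ ≤ R) : radialTrunc R x = x := by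
  rw [radialTrunc, max_eq_left hx, div_self hR.ne', one_smul]

/-- Moving the vector with the scaling factor fixed costs at most ‖x − y‖, and so does changing the
factor with the vector fixed; hence the constant 2. -/
theorem norm_radialTrunc_sub_le {R : ℝ} (hR : 0 < R) (x y : E) :
    ‖radialTrunc R x - radialTrunc R y‖ ≤ 2 * ‖x - y‖ := by
  have hx : 0 < max R ‖x‖ := lt_max_of_lt_left hR
  have hy : 0 < max R ‖y‖ := lt_max_of_lt_left hR
  have e : radialTrunc R x - radialTrunc R y =
      (R / max R ‖x‖) • (x - y) + (R / max R ‖x‖ - R / max R ‖y‖) • y := by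
    simp only [radialTrunc, smul_sub, sub_smul]; abel
  have h1 : ‖(R / max R ‖x‖) • (x - y)‖ ≤ ‖x - y‖ := by
    rw [norm_smul, Real.norm_of_nonneg (by positivity)]
    exact mul_le_of_le_one_left (norm_nonneg _) ((div_le_one hx).2 (le_max_left _ _))
  have h2 : ‖(R / max R ‖x‖ - R / max R ‖y‖) • y‖ ≤ ‖x - y‖ := by
    have hd : R / max R ‖x‖ - R / max R ‖y‖ =
        (R / max R ‖x‖) * ((max R ‖y‖ - max R ‖x‖) / max R ‖y‖) := by
      field_simp
    have hm : |max R ‖y‖ - max R ‖x‖| ≤ ‖x - y‖ :=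
      (abs_max_sub_max_le_max R ‖y‖ R ‖x‖).trans (by
        rw [sub_self, abs_zero, max_eq_right (abs_nonneg _), norm_sub_rev x y]
        exact abs_norm_sub_norm_le y x)
    rw [norm_smul, hd, norm_mul, Real.norm_of_nonneg (by positivity : 0 ≤ R / max R ‖x‖),
      norm_div, Real.norm_of_nonneg hy.le, mul_assoc]
    refine (mul_le_of_le_one_left (by positivity) ((div_le_one hx).2 (le_max_left _ _))).trans ?_
    rw [div_mul_eq_mul_div, div_le_iff₀ hy]
    exact mul_le_mul hm (le_max_right _ _) (norm_nonneg _) (norm_nonneg _)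
  rw [e, two_mul]
  exact (norm_add_le _ _).trans (add_le_add h1 h2)

variable [CompleteSpace E]

open scoped NNReal in
-- Truncating the state makes the right-hand side bounded, so Picard–Lindelöf works on the whole
-- interval at once. Grönwall then keeps the solution within radius `R`, where the truncation does
-- nothing.
theorem exists_linear_ode_Icc {L : ℝ → E →L[ℝ] E} (hL : Continuous L) (x₀ : E) {c : ℝ}
    (hc : 0 ≤ c) : ∃ x : ℝ → E, x 0 = x₀ ∧
      ∀ t ∈ Set.Icc 0 c, HasDerivWithinAt x (L t (x t)) (Set.Icc 0 c) t := by
  obtain ⟨C, hC⟩ := isCompact_Icc.exists_bound_of_continuousOn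
    (hL.continuousOn (s := Set.Icc 0 c))
  have hC0 : 0 ≤ C := (norm_nonneg _).trans (hC 0 ⟨le_rfl, hc⟩)
  lift C to ℝ≥0 using hC0
  -- The Grönwall bound for the untruncated equation, plus 1 to make the radius positive.
  set R : ℝ := ‖x₀‖ * Real.exp (C * c) + 1 with hRdef
  have hR : 0 < R := by positivity
  let a : ℝ≥0 := ⟨C * R * c, by positivity⟩
  have hpl : IsPicardLindelof (fun t x => L t (radialTrunc R x))
      (⟨0, le_rfl, hc⟩ : Set.Icc (0 : ℝ) c) x₀ a 0 (C * ⟨R, hR.le⟩) (C * 2) := by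
    refine ⟨fun t ht => ?_, fun x _ => ?_, fun t ht x _ => ?_, ?_⟩
    · refine LipschitzWith.lipschitzOnWith (LipschitzWith.of_dist_le_mul fun x y => ?_)
      rw [dist_eq_norm, ← map_sub, dist_eq_norm]
      refine ((L t).le_opNorm _).trans ?_
      rw [NNReal.coe_mul, mul_assoc]
      exact mul_le_mul (hC t ht) (norm_radialTrunc_sub_le hR x y) (norm_nonneg _) C.2
    · exact (hL.clm_apply continuous_const).continuousOn
    · refine ((L t).le_opNorm _).trans ?_
      exact mul_le_mul (hC t ht) (norm_radialTrunc_le hR x) (norm_nonneg _) C.2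
    · simp only [sub_zero, NNReal.coe_zero, max_eq_left hc]
      exact le_rfl
  obtain ⟨x, hx0, hx⟩ := hpl.exists_eq_forall_mem_Icc_hasDerivWithinAt₀
  refine ⟨x, hx0, fun t ht => ?_⟩
  have hb := norm_le_gronwallBound_of_norm_deriv_right_le (f := x)
    (f' := fun t => L t (radialTrunc R (x t))) (δ := ‖x₀‖) (K := C) (ε := 0) (a := 0) (b := c)
    (fun t ht => (hx t ht).continuousWithinAt)
    (fun t ht => (hx t (Set.Ico_subset_Icc_self ht)).of_Icc_right ht) (by rw [← hx0])
    (fun t ht => by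
      rw [add_zero]
      exact ((L t).le_opNorm _).trans (mul_le_mul (hC t (Set.Ico_subset_Icc_self ht))
        (norm_radialTrunc_le_norm hR _) (norm_nonneg _) C.2)) t ht
  rw [gronwallBound_ε0, sub_zero] at hb
  have hle : ‖x t‖ ≤ R := by
    refine hb.trans ((mul_le_mul_of_nonneg_left (Real.exp_le_exp.2 ?_) (norm_nonneg _)).trans
      (le_add_of_nonneg_right zero_le_one))
    exact mul_le_mul_of_nonneg_left ht.2 C.2
  have h := hx t ht
  rwa [radialTrunc_of_le hR hle] at h

/-- Linear differential equations have global solutions. -/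
theorem exists_linear_ode {L : ℝ → E →L[ℝ] E} (hL : Continuous L) (x₀ : E) :
    ∃ x : ℝ → E, x 0 = x₀ ∧
      ∀ t, 0 ≤ t → HasDerivWithinAt x (L t (x t)) (Set.Ici 0) t := by
  choose y hy0 hy using fun m : ℕ => exists_linear_ode_Icc hL x₀ (Nat.cast_nonneg (α := ℝ) m)
  have huniq : ∀ m k : ℕ, m ≤ k → ∀ t ∈ Set.Icc (0 : ℝ) m, y k t = y m t := by
    intro m k hmk t ht
    obtain ⟨C, hC⟩ := isCompact_Icc.exists_bound_of_continuousOn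
      (hL.continuousOn (s := Set.Icc 0 (m : ℝ)))
    refine sub_eq_zero.1 (eq_zero_of_norm_deriv_le_Icc (u := fun s => y k s - y m s)
      (u' := fun s => L s (y k s) - L s (y m s)) (c := m) (K := C) (fun s hs => ?_)
      (by simp [hy0]) (fun s hs => ?_) t ht)
    · have hsub : Set.Icc (0 : ℝ) m ⊆ Set.Icc 0 k :=
        Set.Icc_subset_Icc_right (by exact_mod_cast hmk)
      exact ((hy k s (hsub hs)).mono hsub).sub (hy m s hs)
    · rw [← map_sub]
      exact (L s).le_of_opNorm_le (hC s hs) _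
  refine ⟨fun t => y ⌈t⌉₊ t, by simp [hy0], fun t ht => ?_⟩
  -- The extra 1 gives `t < m`, so a derivative within `[0, m]` at `t` is one within `[0, ∞)`.
  set m := ⌈t⌉₊ + 1
  have hlt : t < m := (Nat.le_ceil t).trans_lt (by simp [m])
  have heq : ∀ s ∈ Set.Icc (0 : ℝ) m, y ⌈s⌉₊ s = y m s := fun s hs =>
    (huniq _ _ (Nat.ceil_le.2 hs.2) s ⟨hs.1, Nat.le_ceil s⟩).symm
  have hmem : t ∈ Set.Icc (0 : ℝ) m := ⟨ht, hlt.le⟩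
  have h := (hy m t hmem).congr heq (heq t hmem)
  simp only [heq t hmem]
  refine h.mono_of_mem_nhdsWithin ?_
  have : Set.Icc (0 : ℝ) m = Set.Ici 0 ∩ Set.Iic (m : ℝ) := rfl
  rw [this]
  exact Filter.inter_mem self_mem_nhdsWithin (mem_nhdsWithin_of_mem_nhds (Iic_mem_nhds hlt))

end LinearODE

/-! ### Duhamel's formula and the derivative of the exponential. -/

section ExpDeriv

open NormedSpace

variable {𝔸 : Type*} [NormedRing 𝔸] [NormedAlgebra ℝ 𝔸] [CompleteSpace 𝔸]

/-- Joint continuity in the two exponents and the middle factor is what lets difference quotients of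
exponentials converge under the integral. -/
theorem continuous_duhamel :
    Continuous fun p : 𝔸 × 𝔸 × 𝔸 =>
      ∫ s in (0 : ℝ)..1, exp (s • (-p.1)) * p.2.2 * exp (s • p.2.1) := by
  let _ : NormedAlgebra ℚ 𝔸 := NormedAlgebra.restrictScalars ℚ ℝ 𝔸
  refine intervalIntegral.continuous_parametric_intervalIntegral_of_continuous' ?_ _ _
  have h : Continuous (exp : 𝔸 → 𝔸) := exp_continuous
  unfold Function.uncurry
  fun_prop

/-- Duhamel's formula for the difference of two exponentials. -/
theorem exp_neg_mul_exp_sub_one (A B : 𝔸) :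
    exp (-A) * exp B - 1 = ∫ s in (0 : ℝ)..1, exp (s • (-A)) * (B - A) * exp (s • B) := by
  let _ : NormedAlgebra ℚ 𝔸 := NormedAlgebra.restrictScalars ℚ ℝ 𝔸
  have hd : ∀ s : ℝ, HasDerivAt (fun s : ℝ => exp (s • (-A)) * exp (s • B))
      (exp (s • (-A)) * (B - A) * exp (s • B)) s := by
    intro s
    refine ((hasDerivAt_exp_smul_const (𝕂 := ℝ) (-A) s).mul
      (hasDerivAt_exp_smul_const' (𝕂 := ℝ) B s)).congr_deriv ?_
    noncomm_ring
  have hc : Continuous fun s : ℝ => exp (s • (-A)) * (B - A) * exp (s • B) := by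
    have h : Continuous (exp : 𝔸 → 𝔸) := exp_continuous
    fun_prop
  rw [intervalIntegral.integral_eq_sub_of_hasDerivAt (fun s _ => hd s)
    (hc.intervalIntegrable _ _)]
  simp

theorem exp_mul_exp_neg_self (A : 𝔸) : exp A * exp (-A) = 1 := by
  let _ : NormedAlgebra ℚ 𝔸 := NormedAlgebra.restrictScalars ℚ ℝ 𝔸
  rw [← exp_add_of_commute (Commute.refl A).neg_right, add_neg_cancel, exp_zero]

theorem exp_neg_mul_exp_self (A : 𝔸) : exp (-A) * exp A = 1 := by
  simpa using exp_mul_exp_neg_self (-A)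

/-- The derivative of the exponential along a curve. -/
theorem hasDerivAt_exp_comp {x : ℝ → 𝔸} {x' : 𝔸} {t : ℝ} (hx : HasDerivAt x x' t) :
    HasDerivAt (fun t => exp (x t))
      (exp (x t) * ∫ s in (0 : ℝ)..1, exp (s • (-x t)) * x' * exp (s • x t)) t := by
  have hs := hasDerivAt_iff_tendsto_slope.1 hx
  rw [hasDerivAt_iff_tendsto_slope]
  have hx0 : Filter.Tendsto x (𝓝[≠] t) (𝓝 (x t)) := hx.continuousAt.tendsto.mono_left inf_le_left
  have h := ((continuous_duhamel (𝔸 := 𝔸)).tendsto (x t, x t, x')).comp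
    ((tendsto_const_nhds (x := x t)).prodMk_nhds (hx0.prodMk_nhds hs))
  refine (h.const_mul (exp (x t))).congr fun r => ?_
  -- By Duhamel, the slope of exp ∘ x is exp (x t) times the Duhamel integral with exponents `x t`,
  -- `x r` and middle factor the slope of `x`; continuity gives the limit.
  have e : exp (x r) - exp (x t) = exp (x t) * (exp (-x t) * exp (x r) - 1) := by
    rw [mul_sub, ← mul_assoc, exp_mul_exp_neg_self, one_mul, mul_one]
  simp only [Function.comp_apply, slope_def_module, e, exp_neg_mul_exp_sub_one]
  rw [← mul_smul_comm, ← intervalIntegral.integral_smul]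
  simp only [smul_mul_assoc, mul_smul_comm]

/-- The slope of r ↦ r I(r) at 0 is I(r) itself, so continuity of I and I(0) = V suffice. -/
theorem hasDerivAt_smul_duhamel (A V : 𝔸) :
    HasDerivAt (fun r : ℝ => r • ∫ s in (0 : ℝ)..1, exp (s • (-(r • A))) * V * exp (s • (r • A)))
      V 0 := by
  set I : ℝ → 𝔸 := fun r => ∫ s in (0 : ℝ)..1, exp (s • (-(r • A))) * V * exp (s • (r • A))
    with hI
  have hIc : Continuous I := by
    have hp : Continuous fun r : ℝ => (r • A, r • A, V) := by fun_prop
    exact continuous_duhamel.comp hp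
  have hI0 : I 0 = V := by simp [hI]
  rw [hasDerivAt_iff_tendsto_slope]
  have h : Filter.Tendsto I (𝓝[≠] 0) (𝓝 V) := by
    have h0 := hIc.tendsto 0
    rw [hI0] at h0
    exact h0.mono_left inf_le_left
  refine h.congr' ?_
  filter_upwards [self_mem_nhdsWithin] with r hr
  have hr' : r ≠ 0 := hr
  simp only [slope_def_module, sub_zero, zero_smul]
  exact (inv_smul_smul₀ hr' (I r)).symm

theorem map_integral_exp {F : Type*} [NormedAddCommGroup F] [NormedSpace ℝ F] [CompleteSpace F]
    (Φ : 𝔸 →L[ℝ] F) (M : 𝔸) :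
    Φ (∫ s in (0 : ℝ)..1, exp (-(s • M))) = ∫ s in (0 : ℝ)..1, Φ (exp (-(s • M))) := by
  let _ : NormedAlgebra ℚ 𝔸 := NormedAlgebra.restrictScalars ℚ ℝ 𝔸
  have h : Continuous (exp : 𝔸 → 𝔸) := exp_continuous
  exact (Φ.intervalIntegral_comp_comm
    (Continuous.intervalIntegrable (u := fun s : ℝ => exp (-(s • M))) (by fun_prop) _ _)).symm

end ExpDeriv

/-! ### Integral curves that stay in the closed subgroup. -/

namespace MatrixLieGroup

variable {𝕜 : Type*} [RCLike 𝕜] {N : ℕ} {G : ClosedSubgroup (GL (Fin N) 𝕜)}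

theorem toMat_mul (g h : G) : toMat (g * h) = toMat g * toMat h := rfl

theorem toMat_one : toMat (1 : G) = 1 := rfl

theorem toMat_mul_inv (g : G) : toMat g * toMat g⁻¹ = 1 := by
  rw [← toMat_mul, mul_inv_cancel, toMat_one]

theorem toMat_inv_mul (g : G) : toMat g⁻¹ * toMat g = 1 := by
  rw [← toMat_mul, inv_mul_cancel, toMat_one]

theorem toMat_injective : Function.Injective (toMat : G → Matrix (Fin N) (Fin N) 𝕜) :=
  Units.val_injective.comp Subtype.val_injective

theorem isInducing_toMat : Topology.IsInducing (toMat : G → Matrix (Fin N) (Fin N) 𝕜) :=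
  Units.isOpenEmbedding_val.isInducing.comp Topology.IsInducing.subtypeVal

theorem toMat_mul_mul_inv_mem (g : G) (X : lieAlg G) :
    toMat g * (X : Matrix (Fin N) (Fin N) 𝕜) * toMat g⁻¹ ∈ lieSubmodule G :=
  conj_mem_lieSubmodule G g.2 X.2

theorem hasDerivWithinAt_toMat_inv {q : ℝ → G} {q' : Matrix (Fin N) (Fin N) 𝕜} {s : Set ℝ} {t : ℝ}
    (hq : HasDerivWithinAt (fun r => toMat (q r)) q' s t) :
    HasDerivWithinAt (fun r => toMat (q r)⁻¹) (-(toMat (q t)⁻¹ * q' * toMat (q t)⁻¹)) s t := by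
  have h := (hasFDerivAt_ringInverse (𝕜 := ℝ) (q t : GL (Fin N) 𝕜)).comp_hasDerivWithinAt t hq
  have e : (fun r => toMat (q r)⁻¹) = Ring.inverse ∘ fun r => toMat (q r) := by
    funext r
    exact (Ring.inverse_unit (q r : GL (Fin N) 𝕜)).symm
  rw [e]
  exact h

open Filter in
/-- The distance to `G` along an integral curve of a right-invariant field grows at most
exponentially. -/
theorem eventually_slope_infDist_lt {q : ℝ → Matrix (Fin N) (Fin N) 𝕜}
    {A : Matrix (Fin N) (Fin N) 𝕜} {x r : ℝ} (hA : A ∈ lieSubmodule G)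
    (hq : HasDerivWithinAt q (A * q x) (Set.Ici x) x)
    (hr : ‖A‖ * Metric.infDist (q x) (Set.range (toMat (G := G))) < r) :
    ∀ᶠ z in 𝓝[>] x, (z - x)⁻¹ * (Metric.infDist (q z) (Set.range (toMat (G := G))) -
      Metric.infDist (q x) (Set.range (toMat (G := G)))) < r := by
  set S := Set.range (toMat (G := G))
  have hS : S.Nonempty := ⟨_, Set.mem_range_self 1⟩
  -- The comparison flow e^{(z−x)A} preserves `G` and agrees with the curve to first order at `x`.
  set E : ℝ → Matrix (Fin N) (Fin N) 𝕜 := fun z => NormedSpace.exp ((z - x) • A) with hE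
  have hEx : E x = 1 := by simp [hE]
  have hEd : HasDerivAt E A x := by
    have h := (hasDerivAt_exp_smul_const (𝕂 := ℝ) A (x - x)).comp_sub_const x x
    rw [sub_self, zero_smul, NormedSpace.exp_zero, one_mul] at h
    exact h
  have hrem : HasDerivWithinAt (fun z => q z - E z * q x) 0 (Set.Ici x) x :=
    (hq.sub (hEd.hasDerivWithinAt.mul_const (q x))).congr_deriv (sub_self _)
  have t1 := (hasDerivWithinAt_iff_tendsto_slope' (lt_irrefl x)).1 hEd.hasDerivWithinAt
  have t2 := (hasDerivWithinAt_iff_tendsto_slope' (lt_irrefl x)).1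
    (hasDerivWithinAt_Ioi_iff_Ici.2 hrem)
  have t3 := (t1.norm.mul_const (Metric.infDist (q x) S)).add t2.norm
  rw [norm_zero, add_zero] at t3
  filter_upwards [t3.eventually_lt_const hr, self_mem_nhdsWithin] with z hz hxz
  refine lt_of_le_of_lt ?_ hz
  have hpos : 0 < (z - x)⁻¹ := inv_pos.2 (sub_pos.2 hxz)
  simp only [slope_def_module, norm_smul, Real.norm_of_nonneg hpos.le, hEx, one_mul, sub_self,
    sub_zero]
  rw [mul_assoc, ← mul_add]
  refine mul_le_mul_of_nonneg_left ?_ hpos.le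
  rw [sub_le_iff_le_add]
  have hc : 0 < 1 + ‖E z - 1‖ := by positivity
  -- For each g in `G`, E(z)g is again in `G`; comparing q(z) with it gives this bound. The quotient
  -- isolates dist(q x, g), so that the infimum over g can be taken.
  have key : (Metric.infDist (q z) S - ‖q z - E z * q x‖) / (1 + ‖E z - 1‖) ≤
      Metric.infDist (q x) S := by
    refine (Metric.le_infDist hS).2 ?_
    rintro _ ⟨g, rfl⟩
    rw [div_le_iff₀ hc, sub_le_iff_le_add, dist_eq_norm]
    have hm : E z * toMat g ∈ S := ⟨⟨expGL ((z - x) • A), hA _⟩ * g, rfl⟩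
    refine (Metric.infDist_le_dist_of_mem hm).trans ?_
    rw [dist_eq_norm]
    have e : q z - E z * toMat g =
        (q x - toMat g) + (E z - 1) * (q x - toMat g) + (q z - E z * q x) := by
      noncomm_ring
    rw [e, mul_add, mul_one, mul_comm ‖q x - toMat g‖]
    exact (norm_add_le _ _).trans (add_le_add_left ((norm_add_le _ _).trans
      (add_le_add_right (norm_mul_le _ _) _)) _)
  rw [div_le_iff₀ hc] at key
  linarith

/-- Integral curves of right-invariant time-dependent vector fields stay in `G`. -/
theorem exists_toMat_eq_of_linear_ode {Z q : ℝ → Matrix (Fin N) (Fin N) 𝕜} (hZc : Continuous Z)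
    (hZ : ∀ t, 0 ≤ t → Z t ∈ lieSubmodule G)
    (hq : ∀ t, 0 ≤ t → HasDerivWithinAt q (Z t * q t) (Set.Ici 0) t) {g₀ : G}
    (hq0 : q 0 = toMat g₀) {t : ℝ} (ht : 0 ≤ t) : ∃ g : G, toMat g = q t := by
  set S := Set.range (toMat (G := G)) with hS
  have hqc : ContinuousOn q (Set.Ici 0) := fun s hs => (hq s hs).continuousWithinAt
  obtain ⟨C, hC⟩ := isCompact_Icc.exists_bound_of_continuousOn
    (hZc.continuousOn (s := Set.Icc 0 t))
  -- The distance to `G` need not be differentiable, hence the lower Dini derivative form of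
  -- Grönwall.
  have hd := le_gronwallBound_of_liminf_deriv_right_le
    (f := fun s => Metric.infDist (q s) S) (f' := fun s => ‖Z s‖ * Metric.infDist (q s) S)
    (δ := 0) (K := C) (ε := 0) (a := 0) (b := t)
    ((Metric.continuous_infDist_pt S).comp_continuousOn (hqc.mono Set.Icc_subset_Ici_self))
    (fun s hs r hr => (eventually_slope_infDist_lt (hZ s hs.1)
      ((hq s hs.1).mono (Set.Ici_subset_Ici.2 hs.1)) hr).frequently)
    (by rw [hq0]; exact (Metric.infDist_zero_of_mem (Set.mem_range_self g₀)).le)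
    (fun s hs => by
      rw [add_zero]
      exact mul_le_mul_of_nonneg_right (hC s (Set.Ico_subset_Icc_self hs)) Metric.infDist_nonneg)
    t ⟨ht, le_rfl⟩
  rw [gronwallBound_ε0_δ0] at hd
  have hcl : q t ∈ closure S :=
    (Metric.mem_closure_iff_infDist_zero ⟨_, Set.mem_range_self 1⟩).2
      (le_antisymm hd Metric.infDist_nonneg)
  -- `G` is closed only in the general linear group, so q(t) must be shown invertible: the solution
  -- of p' = −pZ is its inverse, because pq is constant.
  obtain ⟨p, hp0, hp⟩ := exists_linear_ode
    (L := fun s => -((ContinuousLinearMap.mul ℝ (Matrix (Fin N) (Fin N) 𝕜)).flip (Z s)))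
    ((ContinuousLinearMap.continuous _).comp hZc).neg (toMat g₀⁻¹)
  have hpq : p t * q t = 1 := by
    have := eq_of_hasDerivWithinAt_zero (u := fun s => p s * q s) (fun s hs => by
      refine ((hp s hs).mul (hq s hs)).congr_deriv ?_
      simp [mul_assoc]) ht
    rw [this, hp0, hq0, toMat_inv_mul]
  let u : GL (Fin N) 𝕜 := ⟨q t, p t, mul_eq_one_comm.1 hpq, hpq⟩
  have hu : u ∈ closure (G : Set (GL (Fin N) 𝕜)) := by
    refine (Units.isOpenEmbedding_val.isInducing.closure_eq_preimage_closure_image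
      (G : Set (GL (Fin N) 𝕜))).symm.subset (closure_mono ?_ hcl)
    rintro _ ⟨g, rfl⟩
    exact ⟨g, g.2, rfl⟩
  exact ⟨⟨u, G.isClosed'.closure_subset hu⟩, rfl⟩

end MatrixLieGroup

/-! ### Linearization of a group-affine field and the representation (1). -/

namespace MatrixLieGroup

variable {𝕜 : Type*} [RCLike 𝕜] {N : ℕ} {G : ClosedSubgroup (GL (Fin N) 𝕜)}

theorem toMat_expG (X : lieAlg G) :
    toMat (expG X) = NormedSpace.exp (X : Matrix (Fin N) (Fin N) 𝕜) := rfl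

theorem expG_zero : expG (0 : lieAlg G) = 1 :=
  toMat_injective (by rw [toMat_expG, toMat_one]; exact NormedSpace.exp_zero)

theorem expG_inv (X : lieAlg G) : (expG X)⁻¹ = expG (-X) :=
  toMat_injective rfl

theorem hasDerivAt_toMat_expG_smul (X : lieAlg G) (s : ℝ) :
    HasDerivAt (fun r : ℝ => toMat (expG (r • X)))
      ((X : Matrix (Fin N) (Fin N) 𝕜) * toMat (expG (s • X))) s :=
  hasDerivAt_exp_smul_const' (𝕂 := ℝ) (X : Matrix (Fin N) (Fin N) 𝕜) s

theorem mem_lieSubmodule_of_hasDerivAt {c : ℝ → Matrix (Fin N) (Fin N) 𝕜}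
    {v : Matrix (Fin N) (Fin N) 𝕜} {t : ℝ} (hc : HasDerivAt c v t)
    (hmem : ∀ s, c s ∈ lieSubmodule G) : v ∈ lieSubmodule G := by
  have hcl : IsClosed (lieSubmodule G : Set (Matrix (Fin N) (Fin N) 𝕜)) :=
    Submodule.closed_of_finiteDimensional _
  exact hcl.mem_of_tendsto (hasDerivAt_iff_tendsto_slope.1 hc) (Filter.Eventually.of_forall
    fun s => (lieSubmodule G).smul_mem _ ((lieSubmodule G).sub_mem (hmem _) (hmem _)))

/-- The part of a group-affine map that satisfies the Leibniz rule. -/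
def multPart (f : G → Matrix (Fin N) (Fin N) 𝕜) (g : G) : Matrix (Fin N) (Fin N) 𝕜 :=
  f g - toMat g * f 1

/-- `T` is the differential at the identity of the multiplicative part of `f`. -/
def HasLinearization (f : G → Matrix (Fin N) (Fin N) 𝕜)
    (T : Matrix (Fin N) (Fin N) 𝕜 →L[ℝ] Matrix (Fin N) (Fin N) 𝕜) : Prop :=
  ∀ (c : ℝ → G) (s : Set ℝ) (t : ℝ) (Z : Matrix (Fin N) (Fin N) 𝕜), c t = 1 →
    HasDerivWithinAt (fun r => toMat (c r)) Z s t →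
    HasDerivWithinAt (fun r => multPart f (c r)) (T Z) s t

variable {f : G → Matrix (Fin N) (Fin N) 𝕜}
  {T : Matrix (Fin N) (Fin N) 𝕜 →L[ℝ] Matrix (Fin N) (Fin N) 𝕜}

/-- Take T = dF(I) − (right multiplication by f(I)) for a local smooth extension F at the identity.
Off the tangent directions T depends on F, which is harmless: it is only compared with A on 𝔤. -/
theorem IsSmooth.exists_hasLinearization (hf : IsSmooth f) : ∃ T, HasLinearization f T := by
  obtain ⟨U, F, hU, h1, hF, hFf⟩ := hf 1
  have hd : DifferentiableAt ℝ F (toMat (1 : G)) :=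
    (hF.contDiffAt (hU.mem_nhds h1)).differentiableAt (by simp)
  refine ⟨LinearMap.toContinuousLinearMap ((fderiv ℝ F (toMat (1 : G))).toLinearMap -
    LinearMap.mulRight ℝ (f 1)), fun c s t Z hc hZ => ?_⟩
  have hct : toMat (c t) = toMat (1 : G) := by rw [hc]
  have h : HasDerivWithinAt (fun r => F (toMat (c r))) (fderiv ℝ F (toMat (1 : G)) Z) s t := by
    have hd' := hd.hasFDerivAt
    rw [← hct] at hd' ⊢
    exact hd'.comp_hasDerivWithinAt t hZ
  have hev : ∀ᶠ r in 𝓝[s] t, f (c r) = F (toMat (c r)) :=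
    (hZ.continuousWithinAt.eventually (hU.mem_nhds
      (show toMat (c t) ∈ U by rw [hct]; exact h1))).mono
      fun r hr => (hFf _ hr).symm
  exact (h.congr_of_eventuallyEq hev (hFf _ (by rw [hct]; exact h1)).symm).sub (hZ.mul_const (f 1))

theorem multPart_one : multPart f 1 = 0 := by
  simp [multPart, toMat_one]

theorem eq_multPart_add (g : G) : f g = multPart f g + toMat g * f 1 := by
  simp [multPart]

theorem IsGroupAffine.multPart_mul (hf : IsGroupAffine f) (g h : G) :
    multPart f (g * h) = multPart f g * toMat h + toMat g * multPart f h := by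
  simp only [multPart, hf g h, toMat_mul]
  noncomm_ring

/-- Writing q(r) = (q(r)q(t)⁻¹)q(t) and applying the Leibniz rule moves the differentiation to the
identity, so only T is needed. -/
theorem IsGroupAffine.hasDerivWithinAt_multPart (hf : IsGroupAffine f) (hT : HasLinearization f T)
    {q : ℝ → G} {Z : Matrix (Fin N) (Fin N) 𝕜} {s : Set ℝ} {t : ℝ}
    (hq : HasDerivWithinAt (fun r => toMat (q r)) (Z * toMat (q t)) s t) :
    HasDerivWithinAt (fun r => multPart f (q r))
      (T Z * toMat (q t) + Z * multPart f (q t)) s t := by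
  have hc : HasDerivWithinAt (fun r => toMat (q r * (q t)⁻¹)) Z s t := by
    refine (hq.mul_const (toMat (q t)⁻¹)).congr_deriv ?_
    rw [mul_assoc, toMat_mul_inv, mul_one]
  have h := ((hT _ s t Z (mul_inv_cancel (q t)) hc).mul_const (toMat (q t))).add
    (hc.mul_const (multPart f (q t)))
  have e : (fun r => multPart f (q r)) = fun r => multPart f (q r * (q t)⁻¹) * toMat (q t) +
      toMat (q r * (q t)⁻¹) * multPart f (q t) := by
    funext r
    rw [← hf.multPart_mul, inv_mul_cancel_right]
  rw [e]
  exact h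

theorem IsGroupAffine.hasDerivWithinAt_comp (hf : IsGroupAffine f) (hT : HasLinearization f T)
    {q : ℝ → G} {Z : Matrix (Fin N) (Fin N) 𝕜} {s : Set ℝ} {t : ℝ}
    (hq : HasDerivWithinAt (fun r => toMat (q r)) (Z * toMat (q t)) s t) :
    HasDerivWithinAt (fun r => f (q r)) (T Z * toMat (q t) + Z * f (q t)) s t := by
  have e : (fun r => f (q r)) = fun r => multPart f (q r) + toMat (q r) * f 1 :=
    funext fun r => eq_multPart_add (f := f) (q r)
  rw [e]
  refine ((hf.hasDerivWithinAt_multPart hT hq).add (hq.mul_const (f 1))).congr_deriv ?_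
  rw [eq_multPart_add (f := f) (q t)]
  noncomm_ring

theorem HasLinearization.hasDerivAt_expG (hT : HasLinearization f T) (X : lieAlg G) :
    HasDerivAt (fun r : ℝ => multPart f (expG (r • X))) (T X) 0 := by
  have h := hasDerivAt_toMat_expG_smul X 0
  rw [zero_smul, expG_zero, toMat_one, mul_one] at h
  exact hasDerivWithinAt_univ.1 (hT _ Set.univ 0 X (by rw [zero_smul, expG_zero])
    (hasDerivWithinAt_univ.2 h))

/-- The multiplicative part on exponentials. -/
theorem IsGroupAffine.multPart_expG (hf : IsGroupAffine f) (hT : HasLinearization f T)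
    (X : lieAlg G) : multPart f (expG X) = toMat (expG X) *
      ∫ s in (0 : ℝ)..1, NormedSpace.exp (s • (-(X : Matrix (Fin N) (Fin N) 𝕜))) * T X *
        NormedSpace.exp (s • (X : Matrix (Fin N) (Fin N) 𝕜)) := by
  set A : Matrix (Fin N) (Fin N) 𝕜 := (X : Matrix (Fin N) (Fin N) 𝕜) with hA
  -- Variation of constants: the factor e^{-sA} cancels the term Aδ in the equation for δ(e^{sA}).
  have hd : ∀ s : ℝ, HasDerivAt
      (fun s : ℝ => NormedSpace.exp (s • (-A)) * multPart f (expG (s • X)))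
      (NormedSpace.exp (s • (-A)) * T A * NormedSpace.exp (s • A)) s := by
    intro s
    have h := hasDerivWithinAt_univ.1 (hf.hasDerivWithinAt_multPart hT
      (hasDerivWithinAt_univ.2 (hasDerivAt_toMat_expG_smul X s)))
    refine ((hasDerivAt_exp_smul_const (𝕂 := ℝ) (-A) s).mul h).congr_deriv ?_
    change NormedSpace.exp (s • (-A)) * (-A) * multPart f (expG (s • X)) +
      NormedSpace.exp (s • (-A)) * (T A * NormedSpace.exp (s • A) + A * multPart f (expG (s • X))) =
      NormedSpace.exp (s • (-A)) * T A * NormedSpace.exp (s • A)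
    noncomm_ring
  have hcont : Continuous fun s : ℝ =>
      NormedSpace.exp (s • (-A)) * T A * NormedSpace.exp (s • A) := by
    have h : Continuous (NormedSpace.exp : Matrix (Fin N) (Fin N) 𝕜 → _) :=
      NormedSpace.exp_continuous
    fun_prop
  rw [intervalIntegral.integral_eq_sub_of_hasDerivAt (fun s _ => hd s)
    (hcont.intervalIntegrable _ _)]
  simp only [zero_smul, one_smul, expG_zero, multPart_one, mul_zero, sub_zero]
  rw [show toMat (expG X) = NormedSpace.exp A from rfl, ← mul_assoc]
  exact ((congrArg (· * multPart f (expG X)) (exp_mul_exp_neg_self A)).trans (one_mul _)).symm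

theorem IsTangent.mul_inv_mem (htan : IsTangent f) (g : G) : f g * toMat g⁻¹ ∈ lieSubmodule G := by
  obtain ⟨X, hX⟩ := htan g
  rw [hX, mul_assoc, toMat_mul_inv, mul_one]
  exact X.2

theorem IsTangent.map_one_mem (htan : IsTangent f) : f 1 ∈ lieAlg G := by
  have h := htan.mul_inv_mem 1
  rwa [inv_one, toMat_one, mul_one] at h

theorem IsTangent.multPart_mul_inv_mem (htan : IsTangent f) (g : G) :
    multPart f g * toMat g⁻¹ ∈ lieSubmodule G := by
  rw [multPart, sub_mul]
  exact (lieSubmodule G).sub_mem (htan.mul_inv_mem g)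
    (toMat_mul_mul_inv_mem g ⟨f 1, htan.map_one_mem⟩)

/-- TX is the velocity at 0 of s ↦ δ(e^{sX})e^{-sX}, a curve in the closed subspace 𝔤. -/
theorem HasLinearization.map_mem (hT : HasLinearization f T) (htan : IsTangent f) (X : lieAlg G) :
    T X ∈ lieAlg G := by
  have h := (hT.hasDerivAt_expG X).mul (hasDerivAt_toMat_expG_smul (-X) 0)
  simp only [zero_smul, expG_zero, multPart_one, zero_mul, add_zero, toMat_one, mul_one] at h
  refine mem_lieSubmodule_of_hasDerivAt h fun s => ?_
  have := htan.multPart_mul_inv_mem (expG (s • X))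
  rwa [expG_inv, ← smul_neg] at this

/-- The differential of the multiplicative part is a derivation. -/
theorem HasLinearization.map_commutator (hT : HasLinearization f T) (hf : IsGroupAffine f)
    (X Y : lieAlg G) :
    T ((X : Matrix (Fin N) (Fin N) 𝕜) * Y - Y * X) = (X * T Y - T Y * X) - (Y * T X - T X * Y) := by
  -- Differentiate δ(e^{sX} e^{tY} e^{-sX}) at t = 0 in two ways: by the definition of T and by the
  -- Leibniz rule. Differentiating the result at s = 0 gives the derivation identity.
  have hconj : ∀ s : ℝ, T (toMat (expG (s • X)) * Y * toMat (expG (s • (-X)))) =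
      multPart f (expG (s • X)) * Y * toMat (expG (s • (-X))) +
      toMat (expG (s • X)) * T Y * toMat (expG (s • (-X))) +
      toMat (expG (s • X)) * Y * multPart f (expG (s • (-X))) := by
    intro s
    have hinv : expG (s • X) * expG (s • (-X)) = 1 := by
      rw [smul_neg, ← expG_inv, mul_inv_cancel]
    have hY := hasDerivAt_toMat_expG_smul Y 0
    have hY' := hT.hasDerivAt_expG Y
    rw [zero_smul, expG_zero, toMat_one, mul_one] at hY
    have h1 := hT (fun t => expG (s • X) * expG (t • Y) * expG (s • (-X))) Set.univ 0
      (toMat (expG (s • X)) * Y * toMat (expG (s • (-X))))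
      (by simp only [zero_smul, expG_zero, mul_one, hinv])
      (hasDerivWithinAt_univ.2 ((hY.const_mul _).mul_const _))
    refine (hasDerivWithinAt_univ.1 h1).unique ?_
    simp only [hf.multPart_mul, toMat_mul]
    refine ((((hY.const_mul (multPart f (expG (s • X)))).add
      (hY'.const_mul (toMat (expG (s • X))))).mul_const (toMat (expG (s • (-X))))).add
      ((hY.const_mul (toMat (expG (s • X)))).mul_const
        (multPart f (expG (s • (-X)))))).congr_deriv ?_
    rw [add_mul]
  have hX := hasDerivAt_toMat_expG_smul X 0
  have hX' := hT.hasDerivAt_expG X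
  have hN := hasDerivAt_toMat_expG_smul (-X) 0
  have hN' := hT.hasDerivAt_expG (-X)
  rw [zero_smul, expG_zero, toMat_one, mul_one] at hX hN
  have hl := T.hasFDerivAt.comp_hasDerivAt (0 : ℝ) ((hX.mul_const (Y : Matrix _ _ 𝕜)).mul hN)
  have hr := ((((hX'.mul_const (Y : Matrix _ _ 𝕜)).mul hN).add
    ((hX.mul_const (T Y)).mul hN)).add ((hX.mul_const (Y : Matrix _ _ 𝕜)).mul hN'))
  have e := (hl.congr_of_eventuallyEq (Filter.Eventually.of_forall fun s =>
    (hconj s).symm)).unique hr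
  simp only [zero_smul, expG_zero, toMat_one, one_mul, mul_one, multPart_one, zero_mul,
    NegMemClass.coe_neg, map_neg] at e
  refine (congrArg T ?_).trans (e.trans ?_) <;> noncomm_ring

/-- The derivation of the Lie algebra defined by a group-affine vector field. -/
def linearizationDerivation (hT : HasLinearization f T) (htan : IsTangent f)
    (hf : IsGroupAffine f) : LieDerivation ℝ (lieAlg G) (lieAlg G) where
  toFun X := ⟨T X, hT.map_mem htan X⟩
  map_add' _ _ := Subtype.ext (map_add T _ _)
  map_smul' c _ := Subtype.ext (map_smul T c _)
  leibniz' X Y := Subtype.ext (hT.map_commutator hf X Y)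

variable {n : ℕ} (b : Module.Basis (Fin n) ℝ (lieAlg G))

/-- Conjugating the curve e^{-r ad_X}V back by e^{rX} gives a curve with zero derivative, hence
constantly V. -/
theorem coe_toLin_exp_ad (X V : lieAlg G) {s : ℝ} (hs : 0 ≤ s) :
    (Matrix.toLin b b (NormedSpace.exp
      (s • (-LinearMap.toMatrix b b (LieAlgebra.ad ℝ (lieAlg G) X)))) V :
        Matrix (Fin N) (Fin N) 𝕜) =
      NormedSpace.exp (s • (-(X : Matrix (Fin N) (Fin N) 𝕜))) * V *
        NormedSpace.exp (s • (X : Matrix (Fin N) (Fin N) 𝕜)) := by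
  set M := LinearMap.toMatrix b b (LieAlgebra.ad ℝ (lieAlg G) X)
  set A : Matrix (Fin N) (Fin N) 𝕜 := (X : Matrix (Fin N) (Fin N) 𝕜)
  let Φ : Matrix (Fin n) (Fin n) ℝ →L[ℝ] Matrix (Fin N) (Fin N) 𝕜 :=
    LinearMap.toContinuousLinearMap ((lieAlg G).toSubmodule.subtype ∘ₗ
      (LinearMap.applyₗ V) ∘ₗ (Matrix.toLin b b).toLinearMap)
  have hΦ : ∀ B, Φ B = (Matrix.toLin b b B V : Matrix (Fin N) (Fin N) 𝕜) := fun _ => rfl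
  have hΦM : ∀ B, Φ (-M * B) = -(A * Φ B - Φ B * A) := by
    intro B
    rw [neg_mul, map_neg, hΦ, hΦ, Matrix.toLin_mul b b b, Matrix.toLin_toMatrix]
    rfl
  have hc : ∀ r : ℝ, HasDerivAt (fun r : ℝ => Φ (NormedSpace.exp (r • (-M))))
      (Φ (-M * NormedSpace.exp (r • (-M)))) r := fun r =>
    Φ.hasFDerivAt.comp_hasDerivAt r (hasDerivAt_exp_smul_const' (𝕂 := ℝ) (-M) r)
  have hconst := eq_of_hasDerivWithinAt_zero
    (u := fun r => NormedSpace.exp (r • A) * Φ (NormedSpace.exp (r • (-M))) *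
      NormedSpace.exp (r • (-A))) (fun r _ => by
      refine ((((hasDerivAt_exp_smul_const (𝕂 := ℝ) A r).mul (hc r)).mul
        (hasDerivAt_exp_smul_const' (𝕂 := ℝ) (-A) r)).congr_deriv ?_).hasDerivWithinAt
      simp only [hΦM, Pi.mul_apply]
      noncomm_ring) hs
  simp only [zero_smul, NormedSpace.exp_zero, one_mul, mul_one] at hconst
  have h1 : Φ 1 = (V : Matrix (Fin N) (Fin N) 𝕜) := by
    rw [hΦ, Matrix.toLin_one]; rfl
  rw [h1] at hconst
  rw [← hconst, ← hΦ, smul_neg s A]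
  set e := NormedSpace.exp (s • A)
  have h2 : NormedSpace.exp (-(s • A)) * e = 1 := exp_neg_mul_exp_self _
  calc _ = (NormedSpace.exp (-(s • A)) * e) * Φ (NormedSpace.exp (s • (-M))) *
        (NormedSpace.exp (-(s • A)) * e) := by rw [h2, one_mul, mul_one]
    _ = _ := by simp only [mul_assoc]

theorem coe_jacobian_apply (X V : lieAlg G) :
    (jacobian b X V : Matrix (Fin N) (Fin N) 𝕜) =
      ∫ s in (0 : ℝ)..1, NormedSpace.exp (s • (-(X : Matrix (Fin N) (Fin N) 𝕜))) * V *
        NormedSpace.exp (s • (X : Matrix (Fin N) (Fin N) 𝕜)) := by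
  set M := LinearMap.toMatrix b b (LieAlgebra.ad ℝ (lieAlg G) X) with hM
  let Φ : Matrix (Fin n) (Fin n) ℝ →L[ℝ] Matrix (Fin N) (Fin N) 𝕜 :=
    LinearMap.toContinuousLinearMap ((lieAlg G).toSubmodule.subtype ∘ₗ
      (LinearMap.applyₗ V) ∘ₗ (Matrix.toLin b b).toLinearMap)
  have h := map_integral_exp Φ M
  refine (show _ = Φ (∫ s in (0 : ℝ)..1, NormedSpace.exp (-(s • M))) from rfl).trans (h.trans ?_)
  refine intervalIntegral.integral_congr fun s hs => ?_
  rw [Set.uIcc_of_le zero_le_one] at hs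
  simp only [← smul_neg]
  exact coe_toLin_exp_ad b X V hs.1

theorem IsGroupAffine.hasForm (hf : IsGroupAffine f) (htan : IsTangent f)
    (hT : HasLinearization f T) :
    HasForm b f (linearizationDerivation hT htan hf) ⟨f 1, htan.map_one_mem⟩ 0 := by
  intro X
  rw [coe_jacobian_apply, eq_multPart_add (f := f), hf.multPart_expG hT X]
  simp [linearizationDerivation]

/-- The drift of any triple representing `f` is the differential of its multiplicative part. -/
theorem HasForm.linearization_eq {D : LieDerivation ℝ (lieAlg G) (lieAlg G)} {Y₁ Y₂ : lieAlg G}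
    (hD : HasForm b f D Y₁ Y₂) (hT : HasLinearization f T) (X : lieAlg G) :
    T X = ((D X + ⁅Y₂, X⁆ : lieAlg G) : Matrix (Fin N) (Fin N) 𝕜) := by
  set A : Matrix (Fin N) (Fin N) 𝕜 := (X : Matrix (Fin N) (Fin N) 𝕜)
  set I : ℝ → Matrix (Fin N) (Fin N) 𝕜 := fun r =>
    ∫ s in (0 : ℝ)..1, NormedSpace.exp (s • (-(r • A))) * (D X : Matrix (Fin N) (Fin N) 𝕜) *
      NormedSpace.exp (s • (r • A)) with hI
  have h1 : f 1 = Y₁ + Y₂ := by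
    have h := hD 0
    simpa [expG_zero, toMat_one] using h
  have hsI : HasDerivAt (fun r : ℝ => r • I r) (D X : Matrix (Fin N) (Fin N) 𝕜) 0 :=
    hasDerivAt_smul_duhamel A (D X : Matrix (Fin N) (Fin N) 𝕜)
  have hX := hasDerivAt_toMat_expG_smul X 0
  -- Since f(I) = Y₁ + Y₂, the Y₁ terms cancel and Y₂ survives only in a commutator, the source of
  -- ad_{Y₂}.
  have hform : (fun r : ℝ => multPart f (expG (r • X))) = fun r : ℝ =>
      toMat (expG (r • X)) * (r • I r) + Y₂ * toMat (expG (r • X)) -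
        toMat (expG (r • X)) * Y₂ := by
    funext r
    have hJ : (jacobian b (r • X) (D (r • X)) : Matrix (Fin N) (Fin N) 𝕜) = r • I r := by
      rw [map_smul, map_smul]
      exact congrArg (r • ·) (coe_jacobian_apply b (r • X) (D X))
    rw [multPart, hD, hJ, h1]
    noncomm_ring
  have h := hT.hasDerivAt_expG X
  rw [hform] at h
  have h' := ((hX.mul hsI).add (hX.const_mul (Y₂ : Matrix (Fin N) (Fin N) 𝕜))).sub
    (hX.mul_const (Y₂ : Matrix (Fin N) (Fin N) 𝕜))
  have e := h.unique h'
  simp only [zero_smul, expG_zero, toMat_one, mul_one, one_mul, mul_zero, zero_add] at e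
  rw [e]
  exact add_sub_assoc _ _ _

end MatrixLieGroup

/-! ### Solutions of the initial value problem and the linear flow. -/

namespace MatrixLieGroup

variable {𝕜 : Type*} [RCLike 𝕜] {N : ℕ} {G : ClosedSubgroup (GL (Fin N) 𝕜)}
  {f : G → Matrix (Fin N) (Fin N) 𝕜}
  {T : Matrix (Fin N) (Fin N) 𝕜 →L[ℝ] Matrix (Fin N) (Fin N) 𝕜}
  {n : ℕ} (b : Module.Basis (Fin n) ℝ (lieAlg G)) {A : Matrix (Fin n) (Fin n) ℝ}

/-- The linear flow `exp (t A)` on the Lie algebra, in the basis `b`. -/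
def linFlow (A : Matrix (Fin n) (Fin n) ℝ) (t : ℝ) (X : lieAlg G) : lieAlg G :=
  Matrix.toLin b b (NormedSpace.exp (t • A)) X

theorem linFlow_zero (A : Matrix (Fin n) (Fin n) ℝ) (X : lieAlg G) : linFlow b A 0 X = X := by
  rw [linFlow, zero_smul, NormedSpace.exp_zero, Matrix.toLin_one]
  rfl

theorem hasDerivAt_linFlow
    (hA : ∀ X : lieAlg G, T X = (Matrix.toLin b b A X : Matrix (Fin N) (Fin N) 𝕜))
    (X : lieAlg G) (t : ℝ) :
    HasDerivAt (fun r => (linFlow b A r X : Matrix (Fin N) (Fin N) 𝕜))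
      (T (linFlow b A t X)) t := by
  let Φ : Matrix (Fin n) (Fin n) ℝ →L[ℝ] Matrix (Fin N) (Fin N) 𝕜 :=
    LinearMap.toContinuousLinearMap ((lieAlg G).toSubmodule.subtype ∘ₗ
      (LinearMap.applyₗ X) ∘ₗ (Matrix.toLin b b).toLinearMap)
  refine (Φ.hasFDerivAt.comp_hasDerivAt t
    (hasDerivAt_exp_smul_const' (𝕂 := ℝ) A t)).congr_deriv ?_
  rw [hA, linFlow, ← LinearMap.comp_apply, ← Matrix.toLin_mul]
  rfl

/-- Solve for the velocity first: Z(t) = e^{tA}(f(g₀)g₀⁻¹), then g' = Zg, which stays in `G`. The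
defect u = f(g) − Zg satisfies u' = Zu and u(0) = 0, so it vanishes. -/
theorem IsGroupAffine.exists_isSolution (hf : IsGroupAffine f) (htan : IsTangent f)
    (hT : HasLinearization f T)
    (hA : ∀ X : lieAlg G, T X = (Matrix.toLin b b A X : Matrix (Fin N) (Fin N) 𝕜)) (g₀ : G) :
    ∃ g : ℝ → G, IsSolution f g₀ g := by
  set Z : ℝ → Matrix (Fin N) (Fin N) 𝕜 := fun t =>
    (linFlow b A t ⟨f g₀ * toMat g₀⁻¹, htan.mul_inv_mem g₀⟩ : lieAlg G) with hZdef
  have hZ : ∀ t, HasDerivAt Z (T (Z t)) t := fun t => hasDerivAt_linFlow b hA _ t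
  have hZ0 : Z 0 = f g₀ * toMat g₀⁻¹ := by
    simp only [hZdef, linFlow_zero]
  have hZc : Continuous Z := continuous_iff_continuousAt.2 fun t => (hZ t).continuousAt
  obtain ⟨q, hq0, hq⟩ := exists_linear_ode
    (L := fun s => ContinuousLinearMap.mul ℝ (Matrix (Fin N) (Fin N) 𝕜) (Z s))
    ((ContinuousLinearMap.continuous _).comp hZc) (toMat g₀)
  have hmem : ∀ t, ∃ g : G, 0 ≤ t → toMat g = q t := by
    intro t
    by_cases ht : 0 ≤ t
    · obtain ⟨g, hg⟩ := exists_toMat_eq_of_linear_ode hZc (fun s _ => Subtype.prop _) hq hq0 ht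
      exact ⟨g, fun _ => hg⟩
    -- An arbitrary value at negative times.
    · exact ⟨1, fun h => absurd h ht⟩
  choose g hg using hmem
  have hgd : ∀ t, 0 ≤ t →
      HasDerivWithinAt (fun s => toMat (g s)) (Z t * toMat (g t)) (Set.Ici 0) t := by
    intro t ht
    rw [hg t ht]
    exact (hq t ht).congr (fun s hs => hg s hs) (hg t ht)
  have hg0 : g 0 = g₀ := toMat_injective (by rw [hg 0 le_rfl, hq0])
  have hfg : ∀ t, 0 ≤ t → f (g t) - Z t * toMat (g t) = 0 := fun t ht =>
    eq_zero_of_norm_deriv_le (u := fun s => f (g s) - Z s * toMat (g s))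
      (u' := fun s => Z s * (f (g s) - Z s * toMat (g s))) (K := fun s => ‖Z s‖)
      (fun s hs => by
        refine ((hf.hasDerivWithinAt_comp hT (hgd s hs)).sub
          ((hZ s).hasDerivWithinAt.mul (hgd s hs))).congr_deriv ?_
        noncomm_ring)
      (by
        change f (g 0) - Z 0 * toMat (g 0) = 0
        rw [hg0, hZ0, mul_assoc, toMat_inv_mul, mul_one, sub_self])
      hZc.norm.continuousOn (fun s _ => norm_mul_le _ _) ht
  refine ⟨g, hg0, fun t ht => ?_⟩
  rw [sub_eq_zero.1 (hfg t ht)]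
  exact hgd t ht

theorem IsGroupAffine.hasDerivWithinAt_velocity (hf : IsGroupAffine f)
    (hT : HasLinearization f T) {g₀ : G} {g : ℝ → G} (hg : IsSolution f g₀ g) {t : ℝ}
    (ht : 0 ≤ t) :
    HasDerivWithinAt (fun s => f (g s) * toMat (g s)⁻¹) (T (f (g t) * toMat (g t)⁻¹))
      (Set.Ici 0) t := by
  have hq : HasDerivWithinAt (fun s => toMat (g s)) (f (g t) * toMat (g t)⁻¹ * toMat (g t))
      (Set.Ici 0) t := by
    rw [mul_assoc, toMat_inv_mul, mul_one]
    exact hg.2 t ht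
  refine ((hf.hasDerivWithinAt_comp hT hq).mul
    (hasDerivWithinAt_toMat_inv (hg.2 t ht))).congr_deriv ?_
  rw [add_mul, mul_assoc (T _), toMat_mul_inv, mul_one]
  noncomm_ring

/-- The velocities agree because both solve Z' = TZ with the same initial value; then both solutions
satisfy one linear equation q' = Zq. -/
theorem IsGroupAffine.eqOn_of_isSolution (hf : IsGroupAffine f) (hT : HasLinearization f T)
    {g₀ : G} {g g' : ℝ → G} (hg : IsSolution f g₀ g) (hg' : IsSolution f g₀ g') :
    Set.EqOn g' g (Set.Ici 0) := by
  have hv : ∀ t, 0 ≤ t → f (g' t) * toMat (g' t)⁻¹ = f (g t) * toMat (g t)⁻¹ := fun t ht =>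
    eq_of_hasDerivWithinAt_clm (fun s hs => hf.hasDerivWithinAt_velocity hT hg' hs)
      (fun s hs => hf.hasDerivWithinAt_velocity hT hg hs) (by simp only [hg.1, hg'.1]) ht
  have hc : ContinuousOn (fun s => f (g s) * toMat (g s)⁻¹) (Set.Ici 0) := fun s hs =>
    (hf.hasDerivWithinAt_velocity hT hg hs).continuousWithinAt
  intro t ht
  refine toMat_injective (sub_eq_zero.1 (eq_zero_of_norm_deriv_le
    (u := fun s => toMat (g' s) - toMat (g s))
    (u' := fun s => f (g s) * toMat (g s)⁻¹ * (toMat (g' s) - toMat (g s)))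
    (K := fun s => ‖f (g s) * toMat (g s)⁻¹‖) (fun s hs => ?_) (by simp only [hg.1, hg'.1, sub_self])
    hc.norm (fun s _ => norm_mul_le _ _) ht))
  refine ((hg'.2 s hs).sub (hg.2 s hs)).congr_deriv ?_
  rw [mul_sub]
  nth_rewrite 1 [← hv s hs]
  rw [mul_assoc, mul_assoc, toMat_inv_mul, toMat_inv_mul, mul_one, mul_one]

/-- Left translates of a solution by exponentials of the linear flow are solutions. -/
theorem IsGroupAffine.isSolution_expG_linFlow_mul (hf : IsGroupAffine f)
    (hT : HasLinearization f T)
    (hA : ∀ X : lieAlg G, T X = (Matrix.toLin b b A X : Matrix (Fin N) (Fin N) 𝕜))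
    {μ₀ : G} {μ : ℝ → G} (hμ : IsSolution f μ₀ μ) (X : lieAlg G) :
    IsSolution f (expG X * μ₀) (fun t => expG (linFlow b A t X) * μ t) := by
  refine ⟨by simp only [linFlow_zero, hμ.1], fun t ht => ?_⟩
  have hp : HasDerivAt (fun s => toMat (expG (linFlow b A s X)))
      (multPart f (expG (linFlow b A t X))) t := by
    -- The integral formula for δ(e^X) coincides with the derivative of exp along the linear flow.
    rw [hf.multPart_expG hT]
    exact hasDerivAt_exp_comp (hasDerivAt_linFlow b hA X t)
  refine (hp.hasDerivWithinAt.mul (hμ.2 t ht)).congr_deriv ?_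
  rw [hf, multPart]
  noncomm_ring

theorem linFlow_matrize (A : Matrix (Fin n) (Fin n) ℝ) (t : ℝ) (ξ : EuclideanSpace ℝ (Fin n)) :
    linFlow b A t (matrize b ξ) =
      matrize b (Matrix.toEuclideanCLM (n := Fin n) (𝕜 := ℝ) (NormedSpace.exp (t • A)) ξ) := by
  have hm : ∀ ζ : EuclideanSpace ℝ (Fin n), matrize b ζ = b.equivFun.symm ζ := fun ζ =>
    (b.equivFun_symm_apply ζ).symm
  apply b.equivFun.injective
  rw [hm, hm, LinearEquiv.apply_symm_apply, linFlow]
  ext i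
  rw [Module.Basis.equivFun_apply, ← LinearMap.toMatrix_mulVec_repr b b, LinearMap.toMatrix_toLin,
    ← Module.Basis.equivFun_apply, LinearEquiv.apply_symm_apply]
  rfl

theorem continuous_coe_matrize :
    Continuous fun ξ : EuclideanSpace ℝ (Fin n) => (matrize b ξ : Matrix (Fin N) (Fin N) 𝕜) := by
  have h : (fun ξ : EuclideanSpace ℝ (Fin n) => (matrize b ξ : Matrix (Fin N) (Fin N) 𝕜)) =
      fun ξ => ∑ i, ξ i • (b i : Matrix (Fin N) (Fin N) 𝕜) := by
    funext ξ
    simp [matrize]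
  rw [h]
  fun_prop

theorem continuous_expG_matrize_mul (μ : G) :
    Continuous fun ξ : EuclideanSpace ℝ (Fin n) => expG (matrize b ξ) * μ := by
  rw [isInducing_toMat.continuous_iff]
  have h : Continuous (NormedSpace.exp : Matrix (Fin N) (Fin N) 𝕜 → _) :=
    NormedSpace.exp_continuous
  exact (h.comp (continuous_coe_matrize b)).mul continuous_const

theorem surjective_expG_matrize_mul (hexp : Function.Surjective (expG (G := G))) (μ : G) :
    Function.Surjective fun ξ : EuclideanSpace ℝ (Fin n) => expG (matrize b ξ) * μ := by
  intro g
  obtain ⟨X, hX⟩ := hexp (g * μ⁻¹)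
  refine ⟨WithLp.toLp 2 (b.equivFun X), ?_⟩
  have : matrize b (WithLp.toLp 2 (b.equivFun X)) = X := b.sum_equivFun X
  simp only [this, hX, inv_mul_cancel_right]

end MatrixLieGroup

/-! ### The Lyapunov equation and linear images of Gaussians. -/

section Lyapunov

variable {n : ℕ} {A S₀ : Matrix (Fin n) (Fin n) ℝ}

/-- The solution of the Lyapunov equation. -/
def lyapunovFlow (A S₀ : Matrix (Fin n) (Fin n) ℝ) (t : ℝ) : Matrix (Fin n) (Fin n) ℝ :=
  NormedSpace.exp (t • A) * S₀ * (NormedSpace.exp (t • A))ᵀ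

theorem isLyapunovSolution_lyapunovFlow (A S₀ : Matrix (Fin n) (Fin n) ℝ) :
    IsLyapunovSolution A S₀ (lyapunovFlow A S₀) := by
  have e : lyapunovFlow A S₀ =
      fun t => NormedSpace.exp (t • A) * S₀ * NormedSpace.exp (t • Aᵀ) := by
    funext t
    rw [lyapunovFlow, ← Matrix.exp_transpose, Matrix.transpose_smul]
  rw [e]
  refine ⟨by simp, fun t _ => HasDerivAt.hasDerivWithinAt ?_⟩
  refine (((hasDerivAt_exp_smul_const' (𝕂 := ℝ) A t).mul_const S₀).mul
    (hasDerivAt_exp_smul_const (𝕂 := ℝ) Aᵀ t)).congr_deriv ?_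
  simp only [mul_assoc]
  rfl

theorem IsLyapunovSolution.eqOn {S S' : ℝ → Matrix (Fin n) (Fin n) ℝ}
    (hS : IsLyapunovSolution A S₀ S) (hS' : IsLyapunovSolution A S₀ S') :
    Set.EqOn S' S (Set.Ici 0) := by
  intro t ht
  refine sub_eq_zero.1 (eq_zero_of_norm_deriv_le (u := fun s => S' s - S s)
    (u' := fun s => A * (S' s - S s) + (S' s - S s) * Aᵀ) (K := fun _ => ‖A‖ + ‖Aᵀ‖)
    (fun s hs => ?_) (by simp only [hS.1, hS'.1, sub_self]) continuousOn_const (fun s _ => ?_) ht)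
  · refine ((hS'.2 s hs).sub (hS.2 s hs)).congr_deriv ?_
    noncomm_ring
  · rw [add_mul, mul_comm ‖Aᵀ‖]
    exact (norm_add_le _ _).trans (add_le_add (norm_mul_le _ _) (norm_mul_le _ _))

theorem Matrix.PosDef.lyapunovFlow (hS₀ : S₀.PosDef) (A : Matrix (Fin n) (Fin n) ℝ) (t : ℝ) :
    (lyapunovFlow A S₀ t).PosDef := by
  have hu : IsUnit (NormedSpace.exp (t • A)) := Matrix.isUnit_exp _
  rw [_root_.lyapunovFlow, ← Matrix.conjTranspose_eq_transpose_of_trivial]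
  exact hS₀.mul_mul_conjTranspose_same (Matrix.vecMul_injective_of_isUnit hu)

/-- Compare characteristic functions: that of the image at t is the original one at Bᵀt, which turns
the quadratic form of S into that of BSBᵀ. -/
theorem multivariateGaussian_map_toEuclideanCLM {S : Matrix (Fin n) (Fin n) ℝ}
    (hS : S.PosSemidef) (B : Matrix (Fin n) (Fin n) ℝ) :
    (multivariateGaussian 0 S).map (Matrix.toEuclideanCLM (n := Fin n) (𝕜 := ℝ) B) =
      multivariateGaussian 0 (B * S * Bᵀ) := by
  have hS' : (B * S * Bᵀ).PosSemidef := by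
    rw [← Matrix.conjTranspose_eq_transpose_of_trivial]
    exact hS.mul_mul_conjTranspose_same B
  have hm : Measurable (Matrix.toEuclideanCLM (n := Fin n) (𝕜 := ℝ) B) :=
    (Matrix.toEuclideanCLM (n := Fin n) (𝕜 := ℝ) B).continuous.measurable
  have : IsProbabilityMeasure
      ((multivariateGaussian 0 S).map (Matrix.toEuclideanCLM (n := Fin n) (𝕜 := ℝ) B)) :=
    Measure.isProbabilityMeasure_map hm.aemeasurable
  refine Measure.ext_of_charFun ?_
  funext t
  have hinner : ∀ x : EuclideanSpace ℝ (Fin n),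
      inner ℝ (Matrix.toEuclideanCLM (n := Fin n) (𝕜 := ℝ) B x) t =
        inner ℝ x (Matrix.toEuclideanCLM (n := Fin n) (𝕜 := ℝ) Bᵀ t) := by
    intro x
    rw [real_inner_comm, Matrix.inner_toEuclideanCLM, Matrix.inner_toEuclideanCLM,
      Matrix.dotProduct_mulVec, ← Matrix.mulVec_transpose, dotProduct_comm]
  have h1 : charFun ((multivariateGaussian 0 S).map
      (Matrix.toEuclideanCLM (n := Fin n) (𝕜 := ℝ) B)) t =
      charFun (multivariateGaussian 0 S) (Matrix.toEuclideanCLM (n := Fin n) (𝕜 := ℝ) Bᵀ t) := by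
    rw [charFun_apply, charFun_apply, integral_map hm.aemeasurable (by fun_prop)]
    simp only [hinner]
  rw [h1, charFun_multivariateGaussian hS, charFun_multivariateGaussian hS', inner_zero_right,
    inner_zero_right, Matrix.ofLp_toEuclideanCLM, ← Matrix.mulVec_mulVec, ← Matrix.mulVec_mulVec,
    Matrix.dotProduct_mulVec _ B, ← Matrix.mulVec_transpose]

end Lyapunov

/-! ### Transport of concentrated Gaussians. -/

namespace MatrixLieGroup

variable {𝕜 : Type*} [RCLike 𝕜] {N : ℕ} {G : ClosedSubgroup (GL (Fin N) 𝕜)}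
  {f : G → Matrix (Fin N) (Fin N) 𝕜}
  {T : Matrix (Fin N) (Fin N) 𝕜 →L[ℝ] Matrix (Fin N) (Fin N) 𝕜}
  {n : ℕ} (b : Module.Basis (Fin n) ℝ (lieAlg G)) {A : Matrix (Fin n) (Fin n) ℝ}

instance instSecondCountableTopologyGroup : SecondCountableTopology G :=
  have : SecondCountableTopology (Matrix (Fin N) (Fin N) 𝕜) :=
    inferInstanceAs (SecondCountableTopology (Fin N → Fin N → 𝕜))
  isInducing_toMat.secondCountableTopology

theorem concentratedGaussian_map {Φ : G → G} {μ₀ μ : G} {S₀ : Matrix (Fin n) (Fin n) ℝ}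
    (hS₀ : S₀.PosSemidef) (hΦm : Measurable Φ) (t : ℝ)
    (hΦ : ∀ X, Φ (expG X * μ₀) = expG (linFlow b A t X) * μ) :
    (concentratedGaussian b μ₀ S₀).map Φ = concentratedGaussian b μ (lyapunovFlow A S₀ t) := by
  have hm : ∀ ν : G, Measurable fun ξ : EuclideanSpace ℝ (Fin n) => expG (matrize b ξ) * ν :=
    fun ν => (continuous_expG_matrize_mul b ν).measurable
  rw [concentratedGaussian, concentratedGaussian, lyapunovFlow,
    ← multivariateGaussian_map_toEuclideanCLM hS₀, Measure.map_map hΦm (hm _),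
    Measure.map_map (hm _) (ContinuousLinearMap.continuous _).measurable]
  congr 1
  funext ξ
  simp only [Function.comp_apply, hΦ, linFlow_matrize]

/-- A map of `G` that transports exponentials by a linear flow is Borel measurable. -/
theorem measurable_of_expG_mul (hexp : Function.Surjective (expG (G := G))) {Φ : G → G}
    {μ₀ μ : G} {t : ℝ} (hΦ : ∀ X, Φ (expG X * μ₀) = expG (linFlow b A t X) * μ) :
    Measurable Φ := by
  -- Measurability descends along the Borel surjection ξ ↦ e^{M(ξ)}μ₀, so no continuous dependence
  -- on initial values is needed; surjectivity of exp enters here.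
  refine ((continuous_expG_matrize_mul b μ₀).measurable.measurable_comp_iff_of_surjective
    (surjective_expG_matrize_mul b hexp μ₀)).1 ?_
  have e : (Φ ∘ fun ξ => expG (matrize b ξ) * μ₀) =
      (fun ξ => expG (matrize b ξ) * μ) ∘
        Matrix.toEuclideanCLM (n := Fin n) (𝕜 := ℝ) (NormedSpace.exp (t • A)) := by
    funext ξ
    simp only [Function.comp_apply, hΦ, linFlow_matrize]
  rw [e]
  exact ((continuous_expG_matrize_mul b μ).comp (ContinuousLinearMap.continuous _)).measurable

end MatrixLieGroup

end

open MatrixLieGroup in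
/-- Concentrated Gaussians are transported to concentrated Gaussians by the flow of a group-affine
vector field. -/
theorem MatrixLieGroup.hasLaw_concentratedGaussian {𝕜 : Type*} [RCLike 𝕜] {N n : ℕ}
    {G : ClosedSubgroup (GL (Fin N) 𝕜)} (b : Module.Basis (Fin n) ℝ (lieAlg G))
    (hexp : Function.Surjective (expG (G := G)))
    {f : G → Matrix (Fin N) (Fin N) 𝕜}
    {T : Matrix (Fin N) (Fin N) 𝕜 →L[ℝ] Matrix (Fin N) (Fin N) 𝕜} (hT : HasLinearization f T)
    (hf : IsGroupAffine f) (htan : IsTangent f) {A : Matrix (Fin n) (Fin n) ℝ}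
    (hA : ∀ X : lieAlg G, T X = (Matrix.toLin b b A X : Matrix (Fin N) (Fin N) 𝕜))
    {μ₀ : G} {μ : ℝ → G} (hμ : IsSolution f μ₀ μ) {S₀ : Matrix (Fin n) (Fin n) ℝ}
    (hS₀ : S₀.PosSemidef) {Ω : Type*} [MeasurableSpace Ω] {P : Measure Ω} {g : ℝ → Ω → G}
    (hg0 : HasLaw (g 0) (concentratedGaussian b μ₀ S₀) P)
    (hg : ∀ᵐ ω ∂P, IsSolution f (g 0 ω) (fun t => g t ω)) {t : ℝ} (ht : 0 ≤ t) :
    HasLaw (g t) (concentratedGaussian b (μ t) (lyapunovFlow A S₀ t)) P := by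
  choose Φ hΦ using hf.exists_isSolution b htan hT hA
  have hΦt : ∀ X, Φ (expG X * μ₀) t = expG (linFlow b A t X) * μ t := fun X =>
    hf.eqOn_of_isSolution hT (hf.isSolution_expG_linFlow_mul b hT hA hμ X) (hΦ _) ht
  have hm : Measurable fun h => Φ h t := measurable_of_expG_mul b hexp hΦt
  -- By uniqueness g(t) is almost surely the flow map applied to g(0), which gives both its a.e.
  -- measurability and its law.
  have hae : g t =ᵐ[P] (fun h => Φ h t) ∘ g 0 := by
    filter_upwards [hg] with ω hω
    exact hf.eqOn_of_isSolution hT (hΦ _) hω ht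
  refine ⟨(hm.comp_aemeasurable hg0.aemeasurable).congr hae.symm, ?_⟩
  rw [Measure.map_congr hae, ← AEMeasurable.map_map_of_aemeasurable hm.aemeasurable
    hg0.aemeasurable, hg0.map_eq]
  exact concentratedGaussian_map b hS₀ hm t hΦt

theorem corollary1 {𝕜 : Type*} [RCLike 𝕜] {N n : ℕ} (G : ClosedSubgroup (GL (Fin N) 𝕜))
    (b : Module.Basis (Fin n) ℝ (MatrixLieGroup.lieAlg G))
    (hexp : Function.Surjective (MatrixLieGroup.expG (G := G)))
    (f : G → Matrix (Fin N) (Fin N) 𝕜)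
    (hsmooth : MatrixLieGroup.IsSmooth f) (htangent : MatrixLieGroup.IsTangent f)
    (hf : MatrixLieGroup.IsGroupAffine f)
    (μ₀ : G) (S₀ : Matrix (Fin n) (Fin n) ℝ) (hS₀ : S₀.PosDef) :
    (∃ (D : LieDerivation ℝ (MatrixLieGroup.lieAlg G) (MatrixLieGroup.lieAlg G))
      (Y₁ Y₂ : MatrixLieGroup.lieAlg G), MatrixLieGroup.HasForm b f D Y₁ Y₂) ∧
    (∀ g₀ : G, ∃ g : ℝ → G, MatrixLieGroup.IsSolution f g₀ g ∧
      ∀ g' : ℝ → G, MatrixLieGroup.IsSolution f g₀ g' → Set.EqOn g' g (Set.Ici 0)) ∧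
    ∀ (D : LieDerivation ℝ (MatrixLieGroup.lieAlg G) (MatrixLieGroup.lieAlg G))
      (Y₁ Y₂ : MatrixLieGroup.lieAlg G), MatrixLieGroup.HasForm b f D Y₁ Y₂ →
    ∃ (μ : ℝ → G) (S : ℝ → Matrix (Fin n) (Fin n) ℝ),
      MatrixLieGroup.IsSolution f μ₀ μ ∧
      IsLyapunovSolution (MatrixLieGroup.driftMatrix b D Y₂) S₀ S ∧
      (∀ S' : ℝ → Matrix (Fin n) (Fin n) ℝ,
        IsLyapunovSolution (MatrixLieGroup.driftMatrix b D Y₂) S₀ S' →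
        Set.EqOn S' S (Set.Ici 0)) ∧
      (∀ t : ℝ, 0 ≤ t → (S t).PosDef) ∧
      ∀ {Ω : Type*} [MeasurableSpace Ω] (P : Measure Ω) (g : ℝ → Ω → G),
        HasLaw (g 0) (MatrixLieGroup.concentratedGaussian b μ₀ S₀) P →
        (∀ᵐ ω ∂P, MatrixLieGroup.IsSolution f (g 0 ω) (fun t => g t ω)) →
        ∀ t : ℝ, 0 ≤ t → HasLaw (g t) (MatrixLieGroup.concentratedGaussian b (μ t) (S t)) P := by
  obtain ⟨T, hT⟩ := hsmooth.exists_hasLinearization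
  have hlin : ∀ (D : LieDerivation ℝ (MatrixLieGroup.lieAlg G) (MatrixLieGroup.lieAlg G))
      (Y₁ Y₂ : MatrixLieGroup.lieAlg G), MatrixLieGroup.HasForm b f D Y₁ Y₂ →
      ∀ X : MatrixLieGroup.lieAlg G, T X =
        (Matrix.toLin b b (MatrixLieGroup.driftMatrix b D Y₂) X : Matrix (Fin N) (Fin N) 𝕜) := by
    intro D Y₁ Y₂ hD X
    rw [MatrixLieGroup.driftMatrix, Matrix.toLin_toMatrix, hD.linearization_eq b hT X]
    rfl
  have hform := hf.hasForm b htangent hT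
  -- Existence needs some matrix representing T on 𝔤; the triple just constructed supplies one.
  have hex := hf.exists_isSolution b htangent hT (hlin _ _ _ hform)
  refine ⟨⟨_, _, _, hform⟩, fun g₀ => ?_, fun D Y₁ Y₂ hD => ?_⟩
  · obtain ⟨g, hg⟩ := hex g₀
    exact ⟨g, hg, fun g' hg' => hf.eqOn_of_isSolution hT hg hg'⟩
  · obtain ⟨μ, hμ⟩ := hex μ₀
    have hS := isLyapunovSolution_lyapunovFlow (MatrixLieGroup.driftMatrix b D Y₂) S₀
    exact ⟨μ, lyapunovFlow (MatrixLieGroup.driftMatrix b D Y₂) S₀, hμ, hS,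
      fun S' hS' => hS.eqOn hS', fun t _ => hS₀.lyapunovFlow _ t,
      fun P g hg0 hg t ht => MatrixLieGroup.hasLaw_concentratedGaussian b hexp hT hf htangent
        (hlin D Y₁ Y₂ hD) hμ hS₀.posSemidef hg0 hg ht⟩
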